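/- Let $\mathbb H=\{z\in\mathbb C:\operatorname{Im} z>0\}$ and let $\Phi:\mathbb H\to\mathbb H$ be holomorphic with $$A:=\inf_{z\in\mathbb H}\frac{\operatorname{Im}\Phi(z)}{\operatorname{Im} z}>1$$ (that is, $\Phi$ is of hyperbolic type with Denjoy--Wolff point $\infty$). Let $\Phi_n$ be the $n$-th iterate of $\Phi$. For $z_0\in\mathbb H$ write $z_n=\Phi_n(z_0)=x_n+iy_n$ and $\tau_n(z)=(z-x_n)/y_n$. We say that $z\to\infty$ non-tangentially if $z\to\infty$ within a sector $\{z\in\mathbb H:|\operatorname{Arg}z-\pi/2|<\pi/2-\delta\}$ with $\delta>0$; a non-tangential limit at $\infty$ is a limit that holds in every such sector. A map $f:\mathbb H\to\mathbb H$ is called semi-conformal at $\infty$ if $f(z)$ has non-tangential limit $\infty$ at $\infty$ and $\operatorname{Arg}(f(z)/z)$ has non-tangential limit $0$ at $\infty$. Then the following hold. 1. For every $z_0\in\mathbb H$ the limits $\theta(z_0)=\lim_{n\to\infty}\operatorname{Arg} z_n\in(0,\pi)$ and $b_\infty(z_0)=\lim_{n\to\infty}(x_{n+1}-x_n)/y_n\in\mathbb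 R$ exist, $b_\infty(z_0)=(A-1)\cot\theta(z_0)$, and $b_\infty$ depends continuously on $z_0$. 2. For every $z_0\in\mathbb H$ the renormalized iterates $\tau_n\circ\Phi_n$ converge locally uniformly on $\mathbb H$ to a holomorphic map $\sigma:\mathbb H\to\mathbb H$ with $$\sigma\circ\Phi=A\sigma+b_\infty(z_0).$$ The shifted map $\hat\sigma=\sigma+\dfrac{b_\infty(z_0)}{A-1}$ is a holomorphic self-map of $\mathbb H$, is semi-conformal at $\infty$, and satisfies $\hat\sigma\circ\Phi=A\hat\sigma$. Moreover $\theta(z)=\operatorname{Arg}\hat\sigma(z)$ for all $z\in\mathbb H$. 3. For every $\alpha\in(0,\pi)$ there is $z_0\in\mathbb H$ with $\lim_{n\to\infty}\operatorname{Arg}\Phi_n(z_0)=\theta(z_0)=\alpha$. -/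

import Mathlib

/-- The real affine automorphism of the upper half-plane that sends `w` to `i`:
with `w = x + i y` it is `τ(z) = (z - x) / y`. -/
noncomputable def tauMap (w z : ℂ) : ℂ := (z - (w.re : ℂ)) / (w.im : ℂ)

/-- The renormalized iterates `τₙ ∘ Φₙ`, where `Φₙ` is the `n`-th iterate of `Φ` and `τₙ` is the
affine automorphism of the upper half-plane that sends `zₙ = Φₙ(z₀)` to `i`. -/
noncomputable def renormIter (Φ : ℂ → ℂ) (z₀ : ℂ) (n : ℕ) (z : ℂ) : ℂ :=
  tauMap (Φ^[n] z₀) (Φ^[n] z)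

/-- The sector `{z : Im z > 0, |Arg z - π/2| < π/2 - δ}`. -/
def sectorAt (δ : ℝ) : Set ℂ :=
  {z : ℂ | 0 < z.im ∧ |z.arg - Real.pi / 2| < Real.pi / 2 - δ}

/-- Non-tangential limit at infinity in the upper half-plane: `f` tends to `l` as `z → ∞` inside
each sector `sectorAt δ`, `δ > 0`. -/
def KLim {β : Type*} (f : ℂ → β) (l : Filter β) : Prop :=
  ∀ δ : ℝ, 0 < δ →
    Filter.Tendsto f (Bornology.cobounded ℂ ⊓ Filter.principal (sectorAt δ)) l

/-- Semi-conformality at infinity: `f` has non-tangential limit `∞` at `∞`, and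
`Arg (f z / z)` has non-tangential limit `0` at `∞`. -/
def SemiConformalAtInfty (f : ℂ → ℂ) : Prop :=
  KLim f (Bornology.cobounded ℂ) ∧ KLim (fun z => (f z / z).arg) (nhds 0)

/-- A holomorphic self-map of the upper half-plane. -/
def IsHoloSelfMap (f : ℂ → ℂ) : Prop :=
  DifferentiableOn ℂ f UpperHalfPlane.upperHalfPlaneSet ∧
    Set.MapsTo f UpperHalfPlane.upperHalfPlaneSet UpperHalfPlane.upperHalfPlaneSet

/-- `Φ` is a holomorphic self-map of the upper half-plane of hyperbolic type with Denjoy-Wolff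
point at infinity: `A = inf Im Φ(z) / Im z > 1`. -/
def IsHyperbolicSelfMap (Φ : ℂ → ℂ) (A : ℝ) : Prop :=
  IsHoloSelfMap Φ ∧
    IsGLB ((fun z : ℂ => (Φ z).im / z.im) '' UpperHalfPlane.upperHalfPlaneSet) A ∧ 1 < A

/-! By Schwarz-Pick, the hyperbolic distances d(zₙ₊₁, zₙ) and d(zₙ, wₙ) between orbit points are
nonincreasing, hence convergent. Steps of bounded hyperbolic length together with yₙ₊₁ ≥ A yₙ keep
orbits inside a sector, so Julia-Wolff-Carathéodory (`tendsto_div_self`) gives zₙ₊₁ / zₙ → A.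
Inserting this into the limit of d(zₙ₊₁, zₙ) determines the limit of (xₙ/yₙ)²; as xₙ/yₙ moves by
o(1), it converges itself (`exists_tendsto_re_div_im`). In the same way d(zₙ, wₙ) yields a limiting
quadratic equation for Im zₙ / Im wₙ (`exists_tendsto_im_div_im`). Hence V(z) = lim Φₙ(z) / Im Φₙ(w)
exists pointwise, without normal families. It satisfies V ∘ Φ = A V, its argument is θ, and it is
σ̂.

Semi-conformality holds for every holomorphic self-map g with g ∘ Φ = A g. As t → ∞, d(it, Φ(it)) →
log A, whereas d(p, Ap) ≥ log A with equality only for p on the imaginary axis. So Schwarz-Pick for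
g is almost an equality at the pair it, Φ(it), and three-point Schwarz-Pick forces g(tζ) / Im g(it)
→ ζ (`tendsto_renorm`). Thus arg g(tζ) → arg ζ on every ray, and the intermediate value theorem on a
large arc produces every angle. -/

open Complex Filter Topology Set
open scoped ComplexConjugate UpperHalfPlane

/-! ### Two-point and three-point Schwarz-Pick inequalities -/

/-- The Möbius map of the upper half-plane onto the unit disc that sends `w` to `0`. -/
noncomputable def cayleyAt (w z : ℂ) : ℂ := (z - w) / (z - conj w)

theorem normSq_sub_conj (z w : ℂ) :
    normSq (z - conj w) = normSq (z - w) + 4 * (z.im * w.im) := by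
  simp only [normSq_apply, sub_re, sub_im, conj_re, conj_im]; ring

theorem sub_conj_ne_zero {z w : ℂ} (hz : 0 < z.im) (hw : 0 < w.im) : z - conj w ≠ 0 := by
  intro h
  have := congrArg Complex.im h
  simp only [sub_im, conj_im, zero_im] at this
  linarith

theorem normSq_cayleyAt (z w : ℂ) :
    normSq (cayleyAt w z) = normSq (z - w) / (normSq (z - w) + 4 * (z.im * w.im)) := by
  rw [cayleyAt, normSq_div, normSq_sub_conj]

theorem norm_cayleyAt_lt_one {z w : ℂ} (hz : 0 < z.im) (hw : 0 < w.im) :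
    ‖cayleyAt w z‖ < 1 := by
  rw [← sq_lt_one_iff₀ (norm_nonneg _), ← normSq_eq_norm_sq, normSq_cayleyAt]
  have := mul_pos hz hw
  have := normSq_nonneg (z - w)
  rw [div_lt_one (by positivity)]
  linarith

@[simp] theorem cayleyAt_self (w : ℂ) : cayleyAt w w = 0 := by simp [cayleyAt]

theorem differentiableOn_cayleyAt {f : ℂ → ℂ} {s : Set ℂ} {w : ℂ} (hw : 0 < w.im)
    (hf : DifferentiableOn ℂ f s) (hs : ∀ z ∈ s, 0 < (f z).im) :
    DifferentiableOn ℂ (fun z => cayleyAt w (f z)) s :=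
  (hf.sub_const _).div (hf.sub_const _) fun z hz => sub_conj_ne_zero (hs z hz) hw

/-- The Schwarz lemma on the disc, transported by the inverse `c` of `cayleyAt w`. -/
theorem norm_le_norm_cayleyAt {N : ℂ → ℂ} {w z : ℂ}
    (hN : DifferentiableOn ℂ N UpperHalfPlane.upperHalfPlaneSet)
    (hb : ∀ z : ℂ, 0 < z.im → ‖N z‖ ≤ 1) (hw : 0 < w.im) (h0 : N w = 0) (hz : 0 < z.im) :
    ‖N z‖ ≤ ‖cayleyAt w z‖ := by
  let c : ℂ → ℂ := fun ζ => (w - conj w * ζ) / (1 - ζ)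
  have h1 : ∀ ζ ∈ Metric.ball (0 : ℂ) 1, (1 : ℂ) - ζ ≠ 0 := by
    intro ζ hζ h
    rw [sub_eq_zero] at h
    simp [← h] at hζ
  have hc : ∀ ζ ∈ Metric.ball (0 : ℂ) 1, 0 < (c ζ).im := by
    intro ζ hζ
    have hn : 0 < normSq (1 - ζ) := normSq_pos.2 (h1 ζ hζ)
    have hζ' : normSq ζ < 1 := by
      rw [normSq_eq_norm_sq]
      exact (sq_lt_one_iff₀ (norm_nonneg _)).2 (by simpa using hζ)
    have : (c ζ).im = w.im * (1 - normSq ζ) / normSq (1 - ζ) := by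
      simp only [c, div_im, sub_im, sub_re, mul_re, mul_im, conj_re, conj_im, one_re, one_im]
      rw [← sub_div]
      congr 1
      simp only [normSq_apply]
      ring
    rw [this]
    have : 0 < 1 - normSq ζ := by linarith
    positivity
  have hcd : DifferentiableOn ℂ c (Metric.ball 0 1) :=
    ((differentiable_const _).sub
      ((differentiable_const _).mul differentiable_id)).differentiableOn.div
      ((differentiable_const _).sub differentiable_id).differentiableOn h1
  have key := norm_le_norm_of_mapsTo_ball (f := N ∘ c) (R := 1) (z := cayleyAt w z)
    (hN.comp hcd hc) (fun ζ hζ => by simpa using hb _ (hc ζ hζ)) (by simp [c, h0])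
    (norm_cayleyAt_lt_one hz hw)
  have hcz : c (cayleyAt w z) = z := by
    have hne := sub_conj_ne_zero hz hw
    have h2 : w - conj w ≠ 0 := sub_conj_ne_zero hw hw
    have h3 : 1 - cayleyAt w z = (w - conj w) / (z - conj w) := by
      rw [cayleyAt]; field_simp; ring
    simp only [c]
    rw [h3, cayleyAt]
    field_simp
    ring
  simpa [hcz] using key

/-- **Schwarz-Pick** for self-maps of the upper half-plane. -/
theorem norm_cayleyAt_le {f : ℂ → ℂ} (hf : IsHoloSelfMap f) {z w : ℂ}
    (hz : 0 < z.im) (hw : 0 < w.im) :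
    ‖cayleyAt (f w) (f z)‖ ≤ ‖cayleyAt w z‖ :=
  norm_le_norm_cayleyAt (N := fun z => cayleyAt (f w) (f z))
    (differentiableOn_cayleyAt (hf.2 hw) hf.1 hf.2)
    (fun _ hz => (norm_cayleyAt_lt_one (hf.2 hz) (hf.2 hw)).le) hw (by simp) hz

theorem schwarzPick {f : ℂ → ℂ} (hf : IsHoloSelfMap f) {z w : ℂ}
    (hz : 0 < z.im) (hw : 0 < w.im) :
    normSq (f z - f w) * (z.im * w.im) ≤ normSq (z - w) * ((f z).im * (f w).im) := by
  have h := norm_cayleyAt_le hf hz hw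
  rw [← sq_le_sq₀ (norm_nonneg _) (norm_nonneg _), ← normSq_eq_norm_sq, ← normSq_eq_norm_sq,
    normSq_cayleyAt, normSq_cayleyAt] at h
  have h1 := mul_pos hz hw
  have h2 : 0 < (f z).im * (f w).im := mul_pos (hf.2 hz) (hf.2 hw)
  have h3 := normSq_nonneg (z - w)
  have h4 := normSq_nonneg (f z - f w)
  rw [div_le_div_iff₀ (by positivity) (by positivity)] at h
  nlinarith

/-- Needed for Φ(z) - A z, which may be real (Φ may be affine): add iε and let ε → 0. -/
theorem schwarzPick_of_nonneg {f : ℂ → ℂ}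
    (hf : DifferentiableOn ℂ f UpperHalfPlane.upperHalfPlaneSet)
    (hb : ∀ z : ℂ, 0 < z.im → 0 ≤ (f z).im) {z w : ℂ} (hz : 0 < z.im) (hw : 0 < w.im) :
    normSq (f z - f w) * (z.im * w.im) ≤ normSq (z - w) * ((f z).im * (f w).im) := by
  have key : ∀ ε : ℝ, 0 < ε → normSq (f z - f w) * (z.im * w.im) ≤
      normSq (z - w) * (((f z).im + ε) * ((f w).im + ε)) := by
    intro ε hε
    have := schwarzPick (f := fun z => f z + ε * I)
      ⟨hf.add_const _, fun z hz => by
        have := hb z hz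
        change 0 < (f z + ε * I).im
        simp
        linarith⟩ hz hw
    simpa using this
  have hlim : Tendsto (fun ε : ℝ => normSq (z - w) * (((f z).im + ε) * ((f w).im + ε)))
      (𝓝[>] 0) (𝓝 (normSq (z - w) * (((f z).im + 0) * ((f w).im + 0)))) :=
    (Continuous.tendsto (by fun_prop) 0).mono_left nhdsWithin_le_nhds
  simpa using ge_of_tendsto hlim (eventually_mem_nhdsWithin.mono key)

theorem normSq_one_sub_conj_mul (a b : ℂ) :
    normSq (1 - conj b * a) = normSq (a - b) + (1 - normSq a) * (1 - normSq b) := by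
  simp only [normSq_apply, sub_re, sub_im, mul_re, mul_im, conj_re, conj_im, one_re, one_im]; ring

theorem schwarzPick_disc_of_lt {F : ℂ → ℂ}
    (hF : DifferentiableOn ℂ F UpperHalfPlane.upperHalfPlaneSet)
    (hb : ∀ z : ℂ, 0 < z.im → ‖F z‖ < 1) {z w : ℂ} (hz : 0 < z.im) (hw : 0 < w.im) :
    ‖F z - F w‖ ≤ ‖cayleyAt w z‖ * ‖1 - conj (F w) * F z‖ := by
  have hsq : ∀ z : ℂ, 0 < z.im → normSq (F z) < 1 := fun z hz => by
    rw [normSq_eq_norm_sq]; exact (sq_lt_one_iff₀ (norm_nonneg _)).2 (hb z hz)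
  have hpos : ∀ z : ℂ, 0 < z.im → normSq (F z - F w) < normSq (1 - conj (F w) * F z) := by
    intro z hz
    rw [normSq_one_sub_conj_mul]
    have := mul_pos (sub_pos.2 (hsq z hz)) (sub_pos.2 (hsq w hw))
    linarith
  have hne : ∀ z : ℂ, 0 < z.im → 1 - conj (F w) * F z ≠ 0 := fun z hz =>
    normSq_pos.1 ((normSq_nonneg _).trans_lt (hpos z hz))
  -- Follow F by the disc automorphism sending F(w) to 0.
  have key := norm_le_norm_cayleyAt (N := fun z => (F z - F w) / (1 - conj (F w) * F z))
    ((hF.sub_const _).div ((hF.const_mul _).const_sub _) hne)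
    (fun z hz => by
      rw [norm_div, div_le_one (norm_pos_iff.2 (hne z hz)),
        ← sq_le_sq₀ (norm_nonneg _) (norm_nonneg _), ← normSq_eq_norm_sq, ← normSq_eq_norm_sq]
      exact (hpos z hz).le) hw (by simp) hz
  rwa [norm_div, div_le_iff₀ (norm_pos_iff.2 (hne z hz))] at key

/-- The closed bound admits unimodular constants, which are the hyperbolic quotients of
automorphisms; scale by r < 1 and let r → 1. -/
theorem schwarzPick_disc {F : ℂ → ℂ}
    (hF : DifferentiableOn ℂ F UpperHalfPlane.upperHalfPlaneSet)
    (hb : ∀ z : ℂ, 0 < z.im → ‖F z‖ ≤ 1) {z w : ℂ} (hz : 0 < z.im) (hw : 0 < w.im) :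
    ‖F z - F w‖ ≤ ‖cayleyAt w z‖ * ‖1 - conj (F w) * F z‖ := by
  have key : ∀ r ∈ Ioo (0 : ℝ) 1, ‖(r : ℂ) * F z - r * F w‖ ≤
      ‖cayleyAt w z‖ * ‖1 - conj (r * F w) * (r * F z)‖ := by
    intro r hr
    refine schwarzPick_disc_of_lt (F := fun z => r * F z) (hF.const_mul _) (fun z hz => ?_) hz hw
    rw [norm_mul, norm_real, Real.norm_of_nonneg hr.1.le]
    nlinarith [hb z hz, hr.1, hr.2]
  have h1 : Tendsto (fun r : ℝ => ‖(r : ℂ) * F z - r * F w‖) (𝓝[<] 1)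
      (𝓝 ‖((1 : ℝ) : ℂ) * F z - (1 : ℝ) * F w‖) :=
    (Continuous.tendsto (by fun_prop) 1).mono_left nhdsWithin_le_nhds
  have h2 : Tendsto (fun r : ℝ => ‖cayleyAt w z‖ * ‖1 - conj (r * F w) * (r * F z)‖) (𝓝[<] 1)
      (𝓝 (‖cayleyAt w z‖ * ‖1 - conj ((1 : ℝ) * F w) * ((1 : ℝ) * F z)‖)) :=
    (Continuous.tendsto (by fun_prop) 1).mono_left nhdsWithin_le_nhds
  simpa using le_of_tendsto_of_tendsto h1 h2
    (mem_of_superset (Ioo_mem_nhdsLT one_pos) key)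

/-- Three-point **Schwarz-Pick**: the hyperbolic difference quotient of a self-map of the upper
half-plane contracts. -/
theorem exists_cayleyAt_eq_mul {g : ℂ → ℂ} (hg : IsHoloSelfMap g) {w z₁ z : ℂ}
    (hw : 0 < w.im) (hz₁ : 0 < z₁.im) (hz : 0 < z.im) (hne : z₁ ≠ w) :
    ∃ F : ℂ, cayleyAt (g w) (g z) = F * cayleyAt w z ∧
      ‖F - cayleyAt (g w) (g z₁) / cayleyAt w z₁‖ ≤ ‖cayleyAt z₁ z‖ *
        ‖1 - conj (cayleyAt (g w) (g z₁) / cayleyAt w z₁) * F‖ := by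
  let N : ℂ → ℂ := fun z => cayleyAt (g w) (g z)
  -- The quotient `N z / cayleyAt w z` with its singularity at w removed.
  let F : ℂ → ℂ := fun z => dslope N w z * (z - conj w)
  have hopen := UpperHalfPlane.isOpen_upperHalfPlaneSet
  have hN : DifferentiableOn ℂ N UpperHalfPlane.upperHalfPlaneSet :=
    differentiableOn_cayleyAt (hg.2 hw) hg.1 hg.2
  have hFd : DifferentiableOn ℂ F UpperHalfPlane.upperHalfPlaneSet :=
    ((differentiableOn_dslope (hopen.mem_nhds hw)).2 hN).mul
      (differentiableOn_id.sub_const _)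
  have hNF : ∀ z : ℂ, 0 < z.im → N z = F z * cayleyAt w z := by
    intro z hz
    have h := sub_smul_dslope N w z
    have h0 : N w = 0 := by simp [N]
    rw [h0, sub_zero, smul_eq_mul] at h
    have := sub_conj_ne_zero hz hw
    simp only [F, cayleyAt]
    rw [← h]
    field_simp
  have hcne : ∀ z : ℂ, 0 < z.im → z ≠ w → cayleyAt w z ≠ 0 := fun z hz hzw =>
    div_ne_zero (sub_ne_zero.2 hzw) (sub_conj_ne_zero hz hw)
  have hF1' : ∀ z : ℂ, 0 < z.im → z ≠ w → ‖F z‖ ≤ 1 := by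
    intro z hz hzw
    have h := norm_cayleyAt_le hg hz hw
    change ‖N z‖ ≤ _ at h
    rw [hNF z hz, norm_mul] at h
    have := norm_pos_iff.2 (hcne z hz hzw)
    nlinarith
  have hF1 : ∀ z : ℂ, 0 < z.im → ‖F z‖ ≤ 1 := by
    intro z hz
    rcases eq_or_ne z w with rfl | hzw
    · have hc : Tendsto (fun x => ‖F x‖) (𝓝[≠] z) (𝓝 ‖F z‖) :=
        ((hFd.differentiableAt (hopen.mem_nhds hz)).continuousAt.norm.tendsto).mono_left
          nhdsWithin_le_nhds
      refine le_of_tendsto hc ?_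
      filter_upwards [self_mem_nhdsWithin, nhdsWithin_le_nhds (hopen.mem_nhds hz)] with x hx hx'
      exact hF1' x hx' hx
    · exact hF1' z hz hzw
  have hFz₁ : cayleyAt (g w) (g z₁) / cayleyAt w z₁ = F z₁ := by
    rw [div_eq_iff (hcne z₁ hz₁ hne)]
    exact hNF z₁ hz₁
  refine ⟨F z, hNF z hz, ?_⟩
  rw [hFz₁]
  exact schwarzPick_disc hFd hF1 hz hz₁

/-! ### Hyperbolic distance and elementary estimates -/

/-- A strictly increasing function of the hyperbolic distance of two points of the upper
half-plane. -/
noncomputable def hypSq (a b : ℂ) : ℝ := normSq (a - b) / (a.im * b.im)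

theorem hypSq_nonneg {a b : ℂ} (ha : 0 < a.im) (hb : 0 < b.im) : 0 ≤ hypSq a b :=
  div_nonneg (normSq_nonneg _) (mul_pos ha hb).le

theorem normSq_sub_eq_hypSq_mul {a b : ℂ} (ha : 0 < a.im) (hb : 0 < b.im) :
    normSq (a - b) = hypSq a b * (a.im * b.im) := by
  rw [hypSq, div_mul_cancel₀ _ (mul_pos ha hb).ne']

theorem hypSq_map_le {f : ℂ → ℂ} (hf : IsHoloSelfMap f) {a b : ℂ} (ha : 0 < a.im) (hb : 0 < b.im) :
    hypSq (f a) (f b) ≤ hypSq a b := by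
  rw [hypSq, hypSq, div_le_div_iff₀ (mul_pos (hf.2 ha) (hf.2 hb)) (mul_pos ha hb)]
  exact schwarzPick hf ha hb

theorem im_le_of_hypSq_le {a b : ℂ} {S : ℝ} (ha : 0 < a.im) (hb : 0 < b.im) (h : hypSq a b ≤ S) :
    a.im ≤ (S + 2) * b.im := by
  have h1 := normSq_sub_eq_hypSq_mul ha hb
  have h2 : (a.im - b.im) ^ 2 ≤ normSq (a - b) := by
    rw [normSq_apply, sub_re, sub_im]; nlinarith [mul_self_nonneg (a.re - b.re)]
  have h3 : (a.im - b.im) ^ 2 ≤ S * (a.im * b.im) :=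
    h2.trans (h1.le.trans (mul_le_mul_of_nonneg_right h (mul_pos ha hb).le))
  by_contra! hlt
  nlinarith [mul_pos ha hb, mul_lt_mul_of_pos_left hlt ha]

theorem norm_le_of_abs_re_le {z : ℂ} {C : ℝ} (h : |z.re| ≤ C * z.im) (hz : 0 < z.im) :
    ‖z‖ ≤ (C + 1) * z.im := by
  have := norm_le_abs_re_add_abs_im z
  rw [abs_of_pos hz] at this
  linarith

/-- If c > 0, eventually |aₙ| > √c / 2 while steps are shorter than √c / 2, so the sign can no
longer change. -/
theorem exists_tendsto_of_tendsto_sq {a : ℕ → ℝ} {c : ℝ}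
    (h1 : Tendsto (fun n => a (n + 1) - a n) atTop (𝓝 0))
    (h2 : Tendsto (fun n => a n ^ 2) atTop (𝓝 c)) : ∃ l, Tendsto a atTop (𝓝 l) := by
  have habs : Tendsto (fun n => |a n|) atTop (𝓝 √c) := by
    simpa [Real.sqrt_sq_eq_abs] using h2.sqrt
  rcases (Real.sqrt_nonneg c).eq_or_lt with h0 | hpos
  · rw [← h0] at habs
    exact ⟨0, tendsto_zero_iff_abs_tendsto_zero _ |>.2 habs⟩
  set s := √c
  have e1 : ∀ᶠ n in atTop, |a (n + 1) - a n| < s / 2 := by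
    have := (tendsto_zero_iff_abs_tendsto_zero _).1 h1
    exact this.eventually_lt_const (half_pos hpos)
  have e2 : ∀ᶠ n in atTop, s / 2 < |a n| := habs.eventually_const_lt (half_lt_self hpos)
  obtain ⟨N, hN⟩ := eventually_atTop.1 (e1.and e2)
  rcases lt_or_ge 0 (a N) with hs | hs
  · have : ∀ n ≥ N, 0 < a n := by
      intro n hn
      induction n, hn using Nat.le_induction with
      | base => exact hs
      | succ n hn ih =>
        have h := hN n hn
        rw [abs_of_pos ih, abs_lt] at h
        linarith [h.1.1, h.2]
    exact ⟨s, habs.congr' (eventually_atTop.2 ⟨N, fun n hn => abs_of_pos (this n hn)⟩)⟩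
  · have : ∀ n ≥ N, a n ≤ 0 := by
      intro n hn
      induction n, hn using Nat.le_induction with
      | base => exact hs
      | succ n hn ih =>
        have h := hN n hn
        rw [abs_of_nonpos ih, abs_lt] at h
        linarith [h.1.2, h.2]
    refine ⟨-s, habs.neg.congr' (eventually_atTop.2 ⟨N, fun n hn => ?_⟩)⟩
    simp only [abs_of_nonpos (this n hn), neg_neg]

/-! ### Julia-Wolff-Carathéodory at infinity -/

namespace IsHyperbolicSelfMap

variable {Φ : ℂ → ℂ} {A : ℝ}

theorem pos (hΦ : IsHyperbolicSelfMap Φ A) : 0 < A := zero_lt_one.trans hΦ.2.2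

theorem mul_im_le (hΦ : IsHyperbolicSelfMap Φ A) {z : ℂ} (hz : 0 < z.im) :
    A * z.im ≤ (Φ z).im :=
  (le_div_iff₀ hz).1 (hΦ.2.1.1 ⟨z, hz, rfl⟩)

/-- Schwarz-Pick for Φ(z) - A z. When w nearly attains the infimum, ε is small, and in a sector the
last term is O(ε Im z) as z → ∞. -/
theorem norm_sub_mul_le (hΦ : IsHyperbolicSelfMap Φ A) {ε : ℝ} {z w : ℂ}
    (hz : 0 < z.im) (hw : 0 < w.im) (hε : (Φ w - A * w).im ≤ ε * w.im) :
    ‖Φ z - A * z‖ ≤ ‖Φ w - A * w‖ + ε * w.im + ε * normSq (z - w) / z.im := by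
  have hp0 : ∀ z : ℂ, 0 < z.im → 0 ≤ (Φ z - A * z).im := fun z hz => by
    simpa using hΦ.mul_im_le hz
  have hS := schwarzPick_of_nonneg (f := fun z => Φ z - A * z)
    (hΦ.1.1.sub (differentiableOn_id.const_mul _)) hp0 hz hw
  set P := Φ z - A * z
  set Q := Φ w - A * w
  have hQ := hp0 w hw
  have hP := hp0 z hz
  have hε0 : 0 ≤ ε := by
    by_contra! h
    nlinarith
  set K := ε * normSq (z - w) / z.im
  have hK : 0 ≤ K := div_nonneg (mul_nonneg hε0 (normSq_nonneg _)) hz.le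
  have hPle : P.im ≤ ‖P - Q‖ + ε * w.im := by
    have := (le_abs_self _).trans (abs_im_le_norm (P - Q))
    rw [sub_im] at this
    linarith
  -- With X = ‖P - Q‖ this reads X² ≤ K (X + ε Im w), which forces X ≤ K + ε Im w.
  have hsq : ‖P - Q‖ ^ 2 ≤ K * (‖P - Q‖ + ε * w.im) := by
    rw [← normSq_eq_norm_sq]
    have h1 : normSq (P - Q) * (z.im * w.im) ≤
        normSq (z - w) * ((‖P - Q‖ + ε * w.im) * (ε * w.im)) := by
      refine hS.trans ?_
      gcongr
      exact normSq_nonneg _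
    have h2 : K * (‖P - Q‖ + ε * w.im) * (z.im * w.im) =
        normSq (z - w) * ((‖P - Q‖ + ε * w.im) * (ε * w.im)) := by
      simp only [K]; field_simp
    rw [← h2] at h1
    exact le_of_mul_le_mul_right h1 (mul_pos hz hw)
  have hd : ‖P - Q‖ ≤ K + ε * w.im := by
    have hεw := mul_nonneg hε0 hw.le
    by_contra! h
    nlinarith [norm_nonneg (P - Q)]
  have := norm_le_norm_add_norm_sub' P Q
  linarith

/-- The **Julia-Wolff-Carathéodory** theorem at infinity. -/
theorem tendsto_div_self (hΦ : IsHyperbolicSelfMap Φ A) {ι : Type*} {l : Filter ι} {z : ι → ℂ}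
    (him : Tendsto (fun i => (z i).im) l atTop) {C : ℝ}
    (hC : ∀ᶠ i in l, |(z i).re| ≤ C * (z i).im) :
    Tendsto (fun i => Φ (z i) / z i) l (𝓝 A) := by
  have hkey : Tendsto (fun i => (Φ (z i) - A * z i) / z i) l (𝓝 0) := by
    rw [Metric.tendsto_nhds]
    intro η hη
    -- Here 2(C + 1)² comes from |ζ - w|² and 1 absorbs the terms depending only on w; the remaining
    -- 1 makes the final inequality strict.
    set M : ℝ := 2 + 2 * (C + 1) ^ 2
    have hM : 0 < M := by positivity
    set ε := η / M
    have hε : 0 < ε := div_pos hη hM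
    obtain ⟨_, ⟨w, hw, rfl⟩, -, hlt⟩ := hΦ.2.1.exists_between (lt_add_of_pos_right A hε)
    have hw : 0 < w.im := hw
    have hwε : (Φ w - A * w).im ≤ ε * w.im := by
      have := (div_lt_iff₀ hw).1 hlt
      simp only [sub_im, mul_im, ofReal_re, ofReal_im, zero_mul, add_zero]
      linarith
    set K := ‖Φ w - A * w‖ + ε * w.im + 2 * ε * normSq w
    filter_upwards [hC, him.eventually_ge_atTop 1, him.eventually_ge_atTop (K / ε)]
      with i h1 h2 h3
    set ζ := z i
    have hζ : 0 < ζ.im := by linarith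
    have hn : ‖ζ‖ ≤ (C + 1) * ζ.im := norm_le_of_abs_re_le h1 hζ
    have hb := hΦ.norm_sub_mul_le hζ hw hwε
    have h4 : normSq (ζ - w) ≤ 2 * ((C + 1) * ζ.im) ^ 2 + 2 * normSq w := by
      have h5 : normSq ζ ≤ ((C + 1) * ζ.im) ^ 2 := by
        rw [normSq_eq_norm_sq]; gcongr
      have h6 : normSq (ζ - w) ≤ 2 * normSq ζ + 2 * normSq w := by
        have := normSq_nonneg (ζ + w)
        simp only [normSq_apply, sub_re, sub_im, add_re, add_im] at *
        linarith
      linarith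
    have h7 : ε * normSq (ζ - w) / ζ.im ≤ 2 * ε * (C + 1) ^ 2 * ζ.im + 2 * ε * normSq w := by
      rw [div_le_iff₀ hζ]
      have h8 := mul_le_mul_of_nonneg_left h4 hε.le
      have h9 := mul_le_mul_of_nonneg_left h2 (mul_nonneg hε.le (normSq_nonneg w))
      linarith
    have h10 : K ≤ ε * ζ.im := by
      rw [mul_comm]; exact (div_le_iff₀ hε).1 h3
    have h11 : ‖Φ ζ - A * ζ‖ ≤ ε * (M - 1) * ζ.im := by
      simp only [M, K] at *
      linarith
    have hζn : ζ.im ≤ ‖ζ‖ := (le_abs_self _).trans (abs_im_le_norm ζ)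
    rw [dist_zero_right, norm_div, div_lt_iff₀ (hζ.trans_le hζn)]
    have h12 : η = ε * M := by simp only [ε]; field_simp
    have h13 := mul_le_mul_of_nonneg_left hζn hη.le
    have h14 := mul_pos hε hζ
    rw [h12] at *
    linarith
  have := hkey.add_const (A : ℂ)
  rw [zero_add] at this
  refine this.congr' ?_
  filter_upwards [him.eventually_gt_atTop 0] with i hi
  have : z i ≠ 0 := fun h => by simp [h] at hi
  field_simp
  ring

/-! ### Asymptotics of orbits -/

theorem isHoloSelfMap_iterate (hΦ : IsHyperbolicSelfMap Φ A) (n : ℕ) :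
    IsHoloSelfMap (Φ^[n]) := by
  induction n with
  | zero => exact ⟨differentiableOn_id, fun z hz => hz⟩
  | succ n ih =>
    rw [Function.iterate_succ]
    exact ⟨ih.1.comp hΦ.1.1 hΦ.1.2, ih.2.comp hΦ.1.2⟩

theorem iterate_im_pos (hΦ : IsHyperbolicSelfMap Φ A) {z : ℂ} (hz : 0 < z.im) (n : ℕ) :
    0 < (Φ^[n] z).im := (hΦ.isHoloSelfMap_iterate n).2 hz

theorem mul_iterate_im_le (hΦ : IsHyperbolicSelfMap Φ A) {z : ℂ} (hz : 0 < z.im) (n : ℕ) :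
    A * (Φ^[n] z).im ≤ (Φ^[n + 1] z).im := by
  rw [Function.iterate_succ_apply']
  exact hΦ.mul_im_le (hΦ.iterate_im_pos hz n)

theorem tendsto_iterate_im (hΦ : IsHyperbolicSelfMap Φ A) {z : ℂ} (hz : 0 < z.im) :
    Tendsto (fun n => (Φ^[n] z).im) atTop atTop := by
  have h : ∀ n, A ^ n * z.im ≤ (Φ^[n] z).im := by
    intro n
    induction n with
    | zero => simp
    | succ n ih =>
      refine le_trans ?_ (hΦ.mul_iterate_im_le hz n)
      rw [pow_succ', mul_assoc]
      exact mul_le_mul_of_nonneg_left ih hΦ.pos.le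
  exact tendsto_atTop_mono h ((tendsto_pow_atTop_atTop_of_one_lt hΦ.2.2).atTop_mul_const hz)

theorem antitone_hypSq_iterate (hΦ : IsHyperbolicSelfMap Φ A) {z w : ℂ}
    (hz : 0 < z.im) (hw : 0 < w.im) :
    Antitone fun n => hypSq (Φ^[n] z) (Φ^[n] w) := by
  refine antitone_nat_of_succ_le fun n => ?_
  rw [Function.iterate_succ_apply', Function.iterate_succ_apply']
  exact hypSq_map_le hΦ.1 (hΦ.iterate_im_pos hz n) (hΦ.iterate_im_pos hw n)

theorem exists_tendsto_hypSq_iterate (hΦ : IsHyperbolicSelfMap Φ A) {z w : ℂ}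
    (hz : 0 < z.im) (hw : 0 < w.im) :
    ∃ s, Tendsto (fun n => hypSq (Φ^[n] z) (Φ^[n] w)) atTop (𝓝 s) :=
  ⟨_, tendsto_atTop_ciInf (hΦ.antitone_hypSq_iterate hz hw)
    ⟨0, by rintro _ ⟨n, rfl⟩
           exact hypSq_nonneg (hΦ.iterate_im_pos hz n) (hΦ.iterate_im_pos hw n)⟩⟩

theorem iterate_im_le_mul (hΦ : IsHyperbolicSelfMap Φ A) {z w : ℂ}
    (hz : 0 < z.im) (hw : 0 < w.im) (n : ℕ) :
    (Φ^[n] z).im ≤ (hypSq z w + 2) * (Φ^[n] w).im :=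
  im_le_of_hypSq_le (hΦ.iterate_im_pos hz n) (hΦ.iterate_im_pos hw n)
    (hΦ.antitone_hypSq_iterate hz hw (Nat.zero_le n))

/-- Orbits approach infinity non-tangentially. -/
theorem exists_abs_iterate_re_le (hΦ : IsHyperbolicSelfMap Φ A) {z : ℂ} (hz : 0 < z.im) :
    ∃ C, 0 < C ∧ ∀ n, |(Φ^[n] z).re| ≤ C * (Φ^[n] z).im := by
  have hΦz := hΦ.1.2 hz
  set S := hypSq (Φ z) z
  have hS : 0 ≤ S := hypSq_nonneg hΦz hz
  have hA : 0 < A - 1 := sub_pos.2 hΦ.2.2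
  have hstep : ∀ n, |(Φ^[n + 1] z).re - (Φ^[n] z).re| ≤ (S + 2) * (Φ^[n] z).im := by
    intro n
    have h1 := hΦ.iterate_im_le_mul hΦz hz n
    have h2 := hΦ.antitone_hypSq_iterate hΦz hz (Nat.zero_le n)
    have h3 := normSq_sub_eq_hypSq_mul (hΦ.iterate_im_pos hΦz n) (hΦ.iterate_im_pos hz n)
    have h4 := hΦ.iterate_im_pos hz n
    have h5 := hΦ.iterate_im_pos hΦz n
    rw [Function.iterate_succ_apply]
    set a := Φ^[n] (Φ z)
    set b := Φ^[n] z
    have h6 : (a.re - b.re) ^ 2 ≤ normSq (a - b) := by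
      rw [normSq_apply, sub_re, sub_im]; nlinarith [mul_self_nonneg (a.im - b.im)]
    refine abs_le_of_sq_le_sq (h6.trans (h3.le.trans ?_)) (by positivity)
    calc hypSq a b * (a.im * b.im) ≤ S * ((S + 2) * b.im * b.im) := by
          gcongr
          exact h2
      _ ≤ ((S + 2) * b.im) ^ 2 := by
          have := mul_pos h4 h4
          nlinarith
  -- The first entry starts the induction; the second gives C yₙ + (S + 2) yₙ ≤ C A yₙ ≤ C yₙ₊₁.
  refine ⟨max (|z.re| / z.im) ((S + 2) / (A - 1)), lt_max_of_lt_right (by positivity), ?_⟩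
  set C := max (|z.re| / z.im) ((S + 2) / (A - 1))
  have hC : 0 < C := lt_max_of_lt_right (by positivity)
  have hC2 : S + 2 ≤ C * (A - 1) := (div_le_iff₀ hA).1 (le_max_right _ _)
  intro n
  induction n with
  | zero => exact (div_le_iff₀ hz).1 (le_max_left _ _)
  | succ n ih =>
    have h1 := hstep n
    have h2 := abs_sub_abs_le_abs_sub (Φ^[n + 1] z).re (Φ^[n] z).re
    have h3 := mul_le_mul_of_nonneg_left (hΦ.mul_iterate_im_le hz n) hC.le
    have h4 := mul_le_mul_of_nonneg_right hC2 (hΦ.iterate_im_pos hz n).le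
    linarith

theorem tendsto_iterate_succ_div (hΦ : IsHyperbolicSelfMap Φ A) {z : ℂ} (hz : 0 < z.im) :
    Tendsto (fun n => Φ^[n + 1] z / Φ^[n] z) atTop (𝓝 A) := by
  obtain ⟨C, -, hC⟩ := hΦ.exists_abs_iterate_re_le hz
  simp only [Function.iterate_succ_apply']
  exact hΦ.tendsto_div_self (hΦ.tendsto_iterate_im hz) (Eventually.of_forall hC)

theorem tendsto_iterate_succ_sub_div_im (hΦ : IsHyperbolicSelfMap Φ A) {z : ℂ} (hz : 0 < z.im) :
    Tendsto (fun n => (Φ^[n + 1] z - A * Φ^[n] z) / (Φ^[n] z).im) atTop (𝓝 0) := by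
  obtain ⟨C, -, hC⟩ := hΦ.exists_abs_iterate_re_le hz
  have h0 : Tendsto (fun n => Φ^[n + 1] z / Φ^[n] z - A) atTop (𝓝 0) := by
    simpa using (hΦ.tendsto_iterate_succ_div hz).sub_const (A : ℂ)
  have hb : Tendsto (fun n => (Φ^[n + 1] z / Φ^[n] z - A) * (Φ^[n] z / (Φ^[n] z).im))
      atTop (𝓝 0) := by
    refine h0.zero_mul_isBoundedUnder_le ⟨C + 1, eventually_map.2 (Eventually.of_forall fun n => ?_)⟩
    have hn := hΦ.iterate_im_pos hz n
    simp only [Function.comp_apply, norm_div, norm_real, Real.norm_of_nonneg hn.le]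
    rw [div_le_iff₀ hn]
    exact norm_le_of_abs_re_le (hC n) hn
  refine hb.congr fun n => ?_
  have hn := hΦ.iterate_im_pos hz n
  have h1 : Φ^[n] z ≠ 0 := fun h => by simp [h] at hn
  have h2 : ((Φ^[n] z).im : ℂ) ≠ 0 := by exact_mod_cast hn.ne'
  field_simp

theorem tendsto_iterate_succ_im_div (hΦ : IsHyperbolicSelfMap Φ A) {z : ℂ} (hz : 0 < z.im) :
    Tendsto (fun n => (Φ^[n + 1] z).im / (Φ^[n] z).im) atTop (𝓝 A) := by
  have h := ((continuous_im.tendsto _).comp (hΦ.tendsto_iterate_succ_sub_div_im hz)).add_const A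
  rw [zero_im, zero_add] at h
  refine h.congr fun n => ?_
  have hn := hΦ.iterate_im_pos hz n
  simp only [Function.comp_apply, div_ofReal_im, sub_im, mul_im, ofReal_re, ofReal_im]
  field_simp
  ring

theorem tendsto_iterate_succ_re_sub_div (hΦ : IsHyperbolicSelfMap Φ A) {z : ℂ} (hz : 0 < z.im) :
    Tendsto (fun n => ((Φ^[n + 1] z).re - (Φ^[n] z).re) / (Φ^[n] z).im
      - (A - 1) * ((Φ^[n] z).re / (Φ^[n] z).im)) atTop (𝓝 0) := by
  refine ((continuous_re.tendsto _).comp (hΦ.tendsto_iterate_succ_sub_div_im hz)).congr fun n => ?_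
  have hn := hΦ.iterate_im_pos hz n
  simp only [Function.comp_apply, div_ofReal_re, sub_re, mul_re, ofReal_re, ofReal_im]
  field_simp
  ring

theorem isBoundedUnder_re_div_im (hΦ : IsHyperbolicSelfMap Φ A) {z : ℂ} (hz : 0 < z.im) :
    IsBoundedUnder (· ≤ ·) atTop (norm ∘ fun n => (Φ^[n] z).re / (Φ^[n] z).im) := by
  obtain ⟨C, -, hC⟩ := hΦ.exists_abs_iterate_re_le hz
  refine ⟨C, eventually_map.2 (Eventually.of_forall fun n => ?_)⟩
  have hn := hΦ.iterate_im_pos hz n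
  rw [Function.comp_apply, norm_div, Real.norm_eq_abs, Real.norm_of_nonneg hn.le]
  exact (div_le_iff₀ hn).2 (hC n)

theorem exists_tendsto_re_div_im (hΦ : IsHyperbolicSelfMap Φ A) {z : ℂ} (hz : 0 < z.im) :
    ∃ u, Tendsto (fun n => (Φ^[n] z).re / (Φ^[n] z).im) atTop (𝓝 u) := by
  have hA : 0 < A - 1 := sub_pos.2 hΦ.2.2
  have hr := hΦ.tendsto_iterate_succ_im_div hz
  have hβ := hΦ.tendsto_iterate_succ_re_sub_div hz
  have hbd := hΦ.isBoundedUnder_re_div_im hz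
  obtain ⟨s, hs⟩ := hΦ.exists_tendsto_hypSq_iterate (hΦ.1.2 hz) hz
  simp only [← Function.iterate_succ_apply] at hs
  set x : ℕ → ℝ := fun n => (Φ^[n] z).re
  set y : ℕ → ℝ := fun n => (Φ^[n] z).im
  have hy : ∀ n, 0 < y n := hΦ.iterate_im_pos hz
  set v : ℕ → ℝ := fun n => x n / y n
  set r : ℕ → ℝ := fun n => y (n + 1) / y n
  set β : ℕ → ℝ := fun n => (x (n + 1) - x n) / y n
  change Tendsto r atTop (𝓝 A) at hr
  change Tendsto (fun n => β n - (A - 1) * v n) atTop (𝓝 0) at hβ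
  change IsBoundedUnder (· ≤ ·) atTop (norm ∘ v) at hbd
  have hrpos : ∀ n, 0 < r n := fun n => div_pos (hy _) (hy n)
  have hdiff : Tendsto (fun n => v (n + 1) - v n) atTop (𝓝 0) := by
    have h1 : Tendsto (fun n => (r n - A) * v n) atTop (𝓝 0) :=
      Tendsto.zero_mul_isBoundedUnder_le (by simpa using hr.sub_const A) hbd
    have h2 : Tendsto (fun n => ((β n - (A - 1) * v n) - (r n - A) * v n) / r n) atTop
        (𝓝 ((0 - 0) / A)) := (hβ.sub h1).div hr hΦ.pos.ne'
    rw [sub_zero, zero_div] at h2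
    refine h2.congr fun n => ?_
    have := (hy n).ne'
    have := (hy (n + 1)).ne'
    simp only [v, r, β]
    field_simp
    ring
  -- From the identity `hypSq` · r = β² + (r - 1)² for consecutive orbit points.
  have hβ2 : Tendsto (fun n => β n ^ 2) atTop (𝓝 (s * A - (A - 1) ^ 2)) := by
    have h1 := (hs.mul hr).sub ((hr.sub_const 1).pow 2)
    refine h1.congr fun n => ?_
    have := (hy n).ne'
    have := (hy (n + 1)).ne'
    simp only [hypSq, normSq_apply, sub_re, sub_im]
    change ((x (n + 1) - x n) * (x (n + 1) - x n) + (y (n + 1) - y n) * (y (n + 1) - y n)) /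
      (y (n + 1) * y n) * r n - (r n - 1) ^ 2 = _
    simp only [r, β]
    field_simp
    ring
  have hv2 : Tendsto (fun n => v n ^ 2) atTop (𝓝 ((s * A - (A - 1) ^ 2) / (A - 1) ^ 2)) := by
    have h1 : Tendsto (fun n => (β n - (A - 1) * v n) * v n) atTop (𝓝 0) :=
      hβ.zero_mul_isBoundedUnder_le hbd
    have h2 := ((hβ2.sub (hβ.pow 2)).sub (h1.const_mul (2 * (A - 1)))).div_const ((A - 1) ^ 2)
    simp only [ne_eq, OfNat.ofNat_ne_zero, not_false_eq_true, zero_pow, sub_zero, mul_zero] at h2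
    refine h2.congr fun n => ?_
    field_simp
    ring
  exact exists_tendsto_of_tendsto_sq hdiff hv2

theorem exists_tendsto_im_div_im (hΦ : IsHyperbolicSelfMap Φ A) {z w : ℂ}
    (hz : 0 < z.im) (hw : 0 < w.im) :
    ∃ R, 0 < R ∧ Tendsto (fun n => (Φ^[n] z).im / (Φ^[n] w).im) atTop (𝓝 R) := by
  obtain ⟨u, hu⟩ := hΦ.exists_tendsto_re_div_im hz
  obtain ⟨t, ht⟩ := hΦ.exists_tendsto_re_div_im hw
  obtain ⟨s, hs⟩ := hΦ.exists_tendsto_hypSq_iterate hz hw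
  have hrz := hΦ.tendsto_iterate_succ_im_div hz
  have hrw := hΦ.tendsto_iterate_succ_im_div hw
  have hle := hΦ.iterate_im_le_mul hz hw
  have hge := hΦ.iterate_im_le_mul hw hz
  have hypos := hΦ.iterate_im_pos hz
  have hqpos := hΦ.iterate_im_pos hw
  simp only [hypSq, normSq_apply, sub_re, sub_im] at hs
  set x : ℕ → ℝ := fun n => (Φ^[n] z).re
  set y : ℕ → ℝ := fun n => (Φ^[n] z).im
  set p : ℕ → ℝ := fun n => (Φ^[n] w).re
  set q : ℕ → ℝ := fun n => (Φ^[n] w).im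
  change ∀ n, 0 < y n at hypos
  change ∀ n, 0 < q n at hqpos
  set R : ℕ → ℝ := fun n => y n / q n
  have hH := hypSq_nonneg hz hw
  have hRpos : ∀ n, 0 < R n := fun n => div_pos (hypos n) (hqpos n)
  have hRle : ∀ n, R n ≤ hypSq z w + 2 := fun n => (div_le_iff₀ (hqpos n)).2 (hle n)
  have hRge : ∀ n, (hypSq w z + 2)⁻¹ ≤ R n := fun n => by
    have h2 : 0 < hypSq w z + 2 := by linarith [hypSq_nonneg hw hz]
    rw [inv_le_comm₀ h2 (hRpos n), inv_div, div_le_iff₀ (hypos n)]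
    exact hge n
  have hRbd : IsBoundedUnder (· ≤ ·) atTop (norm ∘ R) :=
    ⟨_, eventually_map.2 (Eventually.of_forall fun n => by
      rw [Function.comp_apply, Real.norm_of_nonneg (hRpos n).le]; exact hRle n)⟩
  have hRdiff : Tendsto (fun n => R (n + 1) - R n) atTop (𝓝 0) := by
    have h1 := (hrz.div hrw hΦ.pos.ne').sub_const 1
    rw [div_self hΦ.pos.ne', sub_self] at h1
    refine (h1.zero_mul_isBoundedUnder_le hRbd).congr fun n => ?_
    have := (hypos n).ne'
    have := (hqpos n).ne'
    have := (hqpos (n + 1)).ne'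
    simp only [R, Pi.div_apply]
    change (y (n + 1) / y n / (q (n + 1) / q n) - 1) * (y n / q n) = _
    field_simp
  have hc : 0 < u ^ 2 + 1 := by positivity
  -- Multiplying the formula for `hypSq` by R gives a quadratic in R whose coefficients converge.
  -- Completing the square leaves only a choice of root, which `hRdiff` settles.
  have hquad : Tendsto (fun n => (R n) ^ 2 * (u ^ 2 + 1) - (s + 2 * (u * t + 1)) * R n)
      atTop (𝓝 (-(t ^ 2 + 1))) := by
    have e1 : Tendsto (fun n => (x n / y n) ^ 2 - u ^ 2) atTop (𝓝 0) := by
      have := (hu.pow 2).sub_const (u ^ 2)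
      rwa [sub_self] at this
    have hs0 := hs.sub_const s
    rw [sub_self] at hs0
    have e3 : Tendsto (fun n => (x n / y n) * (p n / q n) - u * t) atTop (𝓝 0) := by
      have := (hu.mul ht).sub_const (u * t)
      rwa [sub_self] at this
    have f1 := ((e1.zero_mul_isBoundedUnder_le hRbd).zero_mul_isBoundedUnder_le hRbd)
    have f2 := hs0.zero_mul_isBoundedUnder_le hRbd
    have f3 := e3.zero_mul_isBoundedUnder_le hRbd
    have f4 := ((f2.sub f1).add (f3.const_mul 2)).sub ((ht.pow 2).add_const 1)
    simp only [sub_zero, mul_zero, add_zero, zero_sub] at f4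
    refine f4.congr fun n => ?_
    have := (hypos n).ne'
    have := (hqpos n).ne'
    change (((x n - p n) * (x n - p n) + (y n - q n) * (y n - q n)) / (y n * q n) - s) * R n
      - ((x n / y n) ^ 2 - u ^ 2) * R n * R n + 2 * ((x n / y n * (p n / q n) - u * t) * R n)
      - ((p n / q n) ^ 2 + 1) = _
    simp only [R]
    field_simp
    ring
  set m := (s + 2 * (u * t + 1)) / (2 * (u ^ 2 + 1))
  have hsq : Tendsto (fun n => (R n - m) ^ 2) atTop (𝓝 (-(t ^ 2 + 1) / (u ^ 2 + 1) + m ^ 2)) := by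
    refine ((hquad.div_const (u ^ 2 + 1)).add_const (m ^ 2)).congr fun n => ?_
    simp only [m]
    field_simp
    ring
  obtain ⟨l, hl⟩ := exists_tendsto_of_tendsto_sq (a := fun n => R n - m)
    (by simpa using hRdiff) hsq
  have hlim : Tendsto R atTop (𝓝 (l + m)) := by simpa using hl.add_const m
  refine ⟨l + m, ?_, hlim⟩
  refine lt_of_lt_of_le ?_ (ge_of_tendsto' hlim hRge)
  have := hypSq_nonneg hw hz
  positivity

end IsHyperbolicSelfMap

/-! ### From pointwise to locally uniform convergence -/

/-- A Lipschitz bound depending on f only through Im f(w), hence uniform along a sequence converging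
at w. Schwarz-Pick first gives ‖f z - f w‖ ≤ M, then, with Im f(z) ≤ 2M, the linear bound. -/
theorem norm_sub_le_of_im_le {f : ℂ → ℂ} (hf : IsHoloSelfMap f) {z w : ℂ} {M : ℝ}
    (hw : 0 < w.im) (hM : (f w).im ≤ M) (hd : ‖z - w‖ ≤ w.im / 2) :
    ‖f z - f w‖ ≤ 2 * M / w.im * ‖z - w‖ := by
  have hz : w.im / 2 ≤ z.im := by
    have := (neg_abs_le _).trans' (neg_le_neg (abs_im_le_norm (z - w)))
    rw [sub_im] at this
    linarith
  have hz0 : 0 < z.im := (half_pos hw).trans_le hz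
  have hfw : 0 < (f w).im := hf.2 hw
  have hM0 : 0 < M := hfw.trans_le hM
  have hS := schwarzPick hf hz0 hw
  rw [normSq_eq_norm_sq, normSq_eq_norm_sq] at hS
  have him : (f z).im ≤ M + ‖f z - f w‖ := by
    have := (le_abs_self _).trans (abs_im_le_norm (f z - f w))
    rw [sub_im] at this
    linarith
  set D := ‖f z - f w‖
  set d := ‖z - w‖
  have hD : 0 ≤ D := norm_nonneg _
  have hd0 : 0 ≤ d := norm_nonneg _
  have h1 : D ^ 2 * (w.im / 2 * w.im) ≤ d ^ 2 * ((M + D) * M) := by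
    refine le_trans (by gcongr) (hS.trans ?_)
    gcongr
  have h2 : D ≤ M := by
    have h3 : d ^ 2 * ((M + D) * M) ≤ (w.im / 2) ^ 2 * ((M + D) * M) := by gcongr
    have h4 : D ^ 2 * 2 ≤ (M + D) * M := by
      have : 0 < (w.im / 2) ^ 2 := by positivity
      refine le_of_mul_le_mul_left ?_ this
      linarith
    by_contra! h
    nlinarith
  have h5 : (D * w.im) ^ 2 ≤ (2 * M * d) ^ 2 := by
    have : d ^ 2 * ((M + D) * M) ≤ d ^ 2 * ((M + M) * M) := by gcongr
    linarith
  rw [div_mul_eq_mul_div, le_div_iff₀ hw]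
  exact le_of_sq_le_sq h5 (by positivity)

/-- Pointwise convergence of self-maps of the upper half-plane is locally uniform. -/
theorem tendstoLocallyUniformlyOn_of_tendsto {f : ℕ → ℂ → ℂ} {g : ℂ → ℂ}
    (hf : ∀ n, IsHoloSelfMap (f n))
    (h : ∀ z : ℂ, 0 < z.im → Tendsto (fun n => f n z) atTop (𝓝 (g z))) :
    TendstoLocallyUniformlyOn f g atTop UpperHalfPlane.upperHalfPlaneSet := by
  rw [Metric.tendstoLocallyUniformlyOn_iff]
  intro ε hε x (hx : 0 < x.im)
  obtain ⟨M, hM⟩ := (((continuous_im.tendsto _).comp (h x hx)).bddAbove_range)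
  have hM' : ∀ n, (f n x).im ≤ M := fun n => hM ⟨n, rfl⟩
  have hM0 : 0 < M := ((hf 0).2 hx : 0 < (f 0 x).im).trans_le (hM' 0)
  have hlip : ∀ n y, ‖y - x‖ ≤ x.im / 2 → ‖f n y - f n x‖ ≤ 2 * M / x.im * ‖y - x‖ :=
    fun n y hy => norm_sub_le_of_im_le (hf n) hx (hM' n) hy
  set L := 2 * M / x.im
  have hL : 0 < L := by positivity
  set r := min (x.im / 2) (ε / (4 * L))
  have hr : 0 < r := by positivity
  refine ⟨Metric.ball x r, mem_nhdsWithin_of_mem_nhds (Metric.ball_mem_nhds x hr), ?_⟩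
  filter_upwards [(Metric.tendsto_nhds.1 (h x hx)) (ε / 4) (by positivity)] with n hn y hy
  rw [mem_ball_iff_norm] at hy
  have hy1 : ‖y - x‖ ≤ x.im / 2 := hy.le.trans (min_le_left _ _)
  have hy2 : L * ‖y - x‖ ≤ ε / 4 := by
    have := hy.le.trans (min_le_right _ _)
    rw [le_div_iff₀ (by positivity)] at this
    linarith
  have hyim : 0 < y.im := by
    have := (neg_abs_le _).trans' (neg_le_neg (abs_im_le_norm (y - x)))
    rw [sub_im] at this
    linarith
  have hg : ‖g y - g x‖ ≤ L * ‖y - x‖ :=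
    le_of_tendsto' ((h y hyim).sub (h x hx)).norm fun n => hlip n y hy1
  have hfn := hlip n y hy1
  have e : g y - f n y = (g y - g x) - (f n x - g x) - (f n y - f n x) := by ring
  rw [dist_eq_norm] at hn ⊢
  rw [e]
  have := norm_sub_le ((g y - g x) - (f n x - g x)) (f n y - f n x)
  have := norm_sub_le (g y - g x) (f n x - g x)
  linarith

/-! ### The Valiron map and its functional equation -/

/-- The limit of `Re Φₙ(z) / Im Φₙ(z)`. -/
noncomputable def orbitSlope (Φ : ℂ → ℂ) (z : ℂ) : ℝ :=
  limUnder atTop fun n : ℕ => (Φ^[n] z).re / (Φ^[n] z).im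

/-- The limit of `Φₙ(z) / Im Φₙ(w)`. -/
noncomputable def valironMap (Φ : ℂ → ℂ) (w z : ℂ) : ℂ :=
  limUnder atTop fun n : ℕ => Φ^[n] z / (Φ^[n] w).im

theorem arg_mem_Ioo_of_im_pos {z : ℂ} (hz : 0 < z.im) : z.arg ∈ Ioo 0 Real.pi := by
  refine ⟨lt_of_le_of_ne (arg_nonneg_iff.2 hz.le) fun h => ?_, arg_lt_pi_iff.2 (Or.inr hz.ne')⟩
  exact hz.ne' (arg_eq_zero_iff.1 h.symm).2

theorem continuousAt_arg_of_im_pos {z : ℂ} (hz : 0 < z.im) : ContinuousAt arg z :=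
  continuousAt_arg (Or.inr hz.ne')

theorem cot_arg {z : ℂ} (hz : 0 < z.im) : Real.cot z.arg = z.re / z.im := by
  have h0 : z ≠ 0 := fun h => by simp [h] at hz
  have := norm_ne_zero_iff.2 h0
  rw [Real.cot_eq_cos_div_sin, cos_arg h0, sin_arg]
  field_simp

theorem arg_re_div_im_add_I {z : ℂ} (hz : 0 < z.im) :
    arg (((z.re / z.im : ℝ) : ℂ) + I) = z.arg := by
  rw [← arg_real_mul (((z.re / z.im : ℝ) : ℂ) + I) hz]
  congr 1
  apply Complex.ext <;> simp
  field_simp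

namespace IsHyperbolicSelfMap

variable {Φ : ℂ → ℂ} {A : ℝ}

theorem tendsto_orbitSlope (hΦ : IsHyperbolicSelfMap Φ A) {z : ℂ} (hz : 0 < z.im) :
    Tendsto (fun n => (Φ^[n] z).re / (Φ^[n] z).im) atTop (𝓝 (orbitSlope Φ z)) :=
  tendsto_nhds_limUnder (hΦ.exists_tendsto_re_div_im hz)

theorem tendsto_step (hΦ : IsHyperbolicSelfMap Φ A) {z : ℂ} (hz : 0 < z.im) :
    Tendsto (fun n => ((Φ^[n + 1] z).re - (Φ^[n] z).re) / (Φ^[n] z).im) atTop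
      (𝓝 ((A - 1) * orbitSlope Φ z)) := by
  simpa using (hΦ.tendsto_iterate_succ_re_sub_div hz).add
    ((hΦ.tendsto_orbitSlope hz).const_mul (A - 1))

theorem tendsto_arg_iterate (hΦ : IsHyperbolicSelfMap Φ A) {z : ℂ} (hz : 0 < z.im) :
    Tendsto (fun n => (Φ^[n] z).arg) atTop (𝓝 (arg (orbitSlope Φ z + I))) := by
  have h : Tendsto (fun n => arg ((((Φ^[n] z).re / (Φ^[n] z).im : ℝ) : ℂ) + I)) atTop
      (𝓝 (arg (orbitSlope Φ z + I))) :=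
    (continuousAt_arg_of_im_pos (by simp)).tendsto.comp
      (((continuous_ofReal.tendsto _).comp (hΦ.tendsto_orbitSlope hz)).add_const I)
  exact h.congr fun n => arg_re_div_im_add_I (hΦ.iterate_im_pos hz n)

theorem exists_tendsto_div_im (hΦ : IsHyperbolicSelfMap Φ A) {z w : ℂ}
    (hz : 0 < z.im) (hw : 0 < w.im) :
    ∃ R : ℝ, 0 < R ∧ Tendsto (fun n => Φ^[n] z / (Φ^[n] w).im) atTop
      (𝓝 (R * (orbitSlope Φ z + I))) := by
  obtain ⟨R, hR, hlim⟩ := hΦ.exists_tendsto_im_div_im hz hw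
  refine ⟨R, hR, (((continuous_ofReal.tendsto _).comp hlim).mul
    (((continuous_ofReal.tendsto _).comp (hΦ.tendsto_orbitSlope hz)).add_const I)).congr fun n => ?_⟩
  have h1 := (hΦ.iterate_im_pos hz n).ne'
  have h2 := (hΦ.iterate_im_pos hw n).ne'
  simp only [Function.comp_apply]
  apply Complex.ext
  · simp only [div_ofReal_re, re_ofReal_mul, add_re, ofReal_re, I_re]
    field_simp
    ring
  · simp only [div_ofReal_im, im_ofReal_mul, add_im, ofReal_im, I_im]
    field_simp
    ring

theorem tendsto_valironMap (hΦ : IsHyperbolicSelfMap Φ A) {z w : ℂ}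
    (hz : 0 < z.im) (hw : 0 < w.im) :
    Tendsto (fun n => Φ^[n] z / (Φ^[n] w).im) atTop (𝓝 (valironMap Φ w z)) :=
  let ⟨_, _, h⟩ := hΦ.exists_tendsto_div_im hz hw
  tendsto_nhds_limUnder ⟨_, h⟩

theorem exists_valironMap_eq (hΦ : IsHyperbolicSelfMap Φ A) {z w : ℂ}
    (hz : 0 < z.im) (hw : 0 < w.im) :
    ∃ R : ℝ, 0 < R ∧ valironMap Φ w z = R * (orbitSlope Φ z + I) :=
  let ⟨R, hR, h⟩ := hΦ.exists_tendsto_div_im hz hw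
  ⟨R, hR, tendsto_nhds_unique (hΦ.tendsto_valironMap hz hw) h⟩

theorem valironMap_im_pos (hΦ : IsHyperbolicSelfMap Φ A) {z w : ℂ}
    (hz : 0 < z.im) (hw : 0 < w.im) : 0 < (valironMap Φ w z).im := by
  obtain ⟨R, hR, h⟩ := hΦ.exists_valironMap_eq hz hw
  simpa [h] using hR

theorem arg_valironMap (hΦ : IsHyperbolicSelfMap Φ A) {z w : ℂ}
    (hz : 0 < z.im) (hw : 0 < w.im) :
    (valironMap Φ w z).arg = arg (orbitSlope Φ z + I) := by
  obtain ⟨R, hR, h⟩ := hΦ.exists_valironMap_eq hz hw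
  rw [h, arg_real_mul _ hR]

/-- The base point w is arbitrary; fixing it turns holomorphy of the Valiron map into continuity of
the slope. -/
theorem orbitSlope_eq_re_div_im (hΦ : IsHyperbolicSelfMap Φ A) {z w : ℂ}
    (hz : 0 < z.im) (hw : 0 < w.im) :
    orbitSlope Φ z = (valironMap Φ w z).re / (valironMap Φ w z).im := by
  obtain ⟨R, hR, h⟩ := hΦ.exists_valironMap_eq hz hw
  rw [h]
  simp [hR.ne']

theorem valironMap_map (hΦ : IsHyperbolicSelfMap Φ A) {z w : ℂ}
    (hz : 0 < z.im) (hw : 0 < w.im) : valironMap Φ w (Φ z) = A * valironMap Φ w z := by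
  refine tendsto_nhds_unique (hΦ.tendsto_valironMap (hΦ.1.2 hz) hw)
    (((hΦ.tendsto_iterate_succ_div hz).mul (hΦ.tendsto_valironMap hz hw)).congr fun n => ?_)
  have h := hΦ.iterate_im_pos hz n
  have h1 : Φ^[n] z ≠ 0 := fun h0 => by simp [h0] at h
  rw [← Function.iterate_succ_apply]
  field_simp

theorem isHoloSelfMap_renormIter (hΦ : IsHyperbolicSelfMap Φ A) {w : ℂ} (hw : 0 < w.im) (n : ℕ) :
    IsHoloSelfMap (renormIter Φ w n) := by
  refine ⟨((hΦ.isHoloSelfMap_iterate n).1.sub_const _).div_const _, fun z hz => ?_⟩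
  change 0 < (renormIter Φ w n z).im
  rw [renormIter, tauMap, div_ofReal_im, sub_im, ofReal_im, sub_zero]
  exact div_pos (hΦ.iterate_im_pos hz n) (hΦ.iterate_im_pos hw n)

theorem tendsto_renormIter (hΦ : IsHyperbolicSelfMap Φ A) {z w : ℂ}
    (hz : 0 < z.im) (hw : 0 < w.im) :
    Tendsto (fun n => renormIter Φ w n z) atTop (𝓝 (valironMap Φ w z - orbitSlope Φ w)) := by
  refine ((hΦ.tendsto_valironMap hz hw).sub
    ((continuous_ofReal.tendsto _).comp (hΦ.tendsto_orbitSlope hw))).congr fun n => ?_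
  simp [renormIter, tauMap, sub_div]

theorem tendstoLocallyUniformlyOn_renormIter (hΦ : IsHyperbolicSelfMap Φ A) {w : ℂ}
    (hw : 0 < w.im) :
    TendstoLocallyUniformlyOn (renormIter Φ w) (fun z => valironMap Φ w z - orbitSlope Φ w) atTop
      UpperHalfPlane.upperHalfPlaneSet :=
  tendstoLocallyUniformlyOn_of_tendsto (hΦ.isHoloSelfMap_renormIter hw)
    fun _ hz => hΦ.tendsto_renormIter hz hw

theorem isHoloSelfMap_valironMap_sub (hΦ : IsHyperbolicSelfMap Φ A) {w : ℂ} (hw : 0 < w.im) :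
    IsHoloSelfMap fun z => valironMap Φ w z - orbitSlope Φ w := by
  refine ⟨(hΦ.tendstoLocallyUniformlyOn_renormIter hw).differentiableOn
    (Eventually.of_forall fun n => (hΦ.isHoloSelfMap_renormIter hw n).1)
    UpperHalfPlane.isOpen_upperHalfPlaneSet, fun z hz => ?_⟩
  change 0 < (valironMap Φ w z - orbitSlope Φ w).im
  simpa using hΦ.valironMap_im_pos hz hw

theorem isHoloSelfMap_valironMap (hΦ : IsHyperbolicSelfMap Φ A) {w : ℂ} (hw : 0 < w.im) :
    IsHoloSelfMap (valironMap Φ w) :=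
  ⟨by simpa using (hΦ.isHoloSelfMap_valironMap_sub hw).1.add_const (orbitSlope Φ w : ℂ),
    fun _ hz => hΦ.valironMap_im_pos hz hw⟩

theorem continuousOn_orbitSlope (hΦ : IsHyperbolicSelfMap Φ A) :
    ContinuousOn (orbitSlope Φ) UpperHalfPlane.upperHalfPlaneSet := by
  have hI : 0 < I.im := by simp
  have hc := (hΦ.isHoloSelfMap_valironMap hI).1.continuousOn
  exact ((continuous_re.comp_continuousOn hc).div (continuous_im.comp_continuousOn hc)
    fun z hz => (hΦ.valironMap_im_pos hz hI).ne').congr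
      fun z hz => hΦ.orbitSlope_eq_re_div_im hz hI

end IsHyperbolicSelfMap

/-! ### Rigidity of solutions of g ∘ Φ = A g near infinity -/

theorem cayleyAt_real_mul {t : ℝ} (ht : t ≠ 0) (w z : ℂ) :
    cayleyAt (t * w) (t * z) = cayleyAt w z := by
  rw [cayleyAt, cayleyAt, map_mul, conj_ofReal, ← mul_sub, ← mul_sub,
    mul_div_mul_left _ _ (ofReal_ne_zero.2 ht)]

theorem eq_div_of_cayleyAt {w z : ℂ} (hw : 0 < w.im) (hz : 0 < z.im) :
    z = (w - conj w * cayleyAt w z) / (1 - cayleyAt w z) := by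
  have hne := sub_conj_ne_zero hz hw
  have h2 : w - conj w ≠ 0 := sub_conj_ne_zero hw hw
  have h3 : 1 - cayleyAt w z = (w - conj w) / (z - conj w) := by
    rw [cayleyAt]; field_simp; ring
  rw [h3, cayleyAt]
  field_simp
  ring

theorem tendsto_cayleyAt {ι : Type*} {l : Filter ι} {w z : ι → ℂ} {w₀ z₀ : ℂ}
    (hw : Tendsto w l (𝓝 w₀)) (hz : Tendsto z l (𝓝 z₀)) (hw₀ : 0 < w₀.im) (hz₀ : 0 < z₀.im) :
    Tendsto (fun i => cayleyAt (w i) (z i)) l (𝓝 (cayleyAt w₀ z₀)) :=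
  (hz.sub hw).div (hz.sub ((continuous_conj.tendsto _).comp hw)) (sub_conj_ne_zero hz₀ hw₀)

/-- If `F₁ → 1` and `F` stays at bounded pseudo-hyperbolic distance from `F₁`, then `F → 1`. -/
theorem tendsto_one_of_norm_sub_le {ι : Type*} {l : Filter ι} {F F₁ : ι → ℂ} {ρ : ι → ℝ} {ρ₀ : ℝ}
    (hF₁ : Tendsto F₁ l (𝓝 1)) (hρ : Tendsto ρ l (𝓝 ρ₀)) (hρ₀ : ρ₀ < 1)
    (hρn : ∀ᶠ i in l, 0 ≤ ρ i)
    (h : ∀ᶠ i in l, ‖F i - F₁ i‖ ≤ ρ i * ‖1 - conj (F₁ i) * F i‖) : Tendsto F l (𝓝 1) := by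
  have h1 : Tendsto (fun i => 1 - ρ i * ‖F₁ i‖) l (𝓝 (1 - ρ₀ * ‖(1 : ℂ)‖)) :=
    (hρ.mul hF₁.norm).const_sub 1
  have h2 : Tendsto (fun i => ρ i * ‖1 - conj (F₁ i) * F₁ i‖) l
      (𝓝 (ρ₀ * ‖1 - conj (1 : ℂ) * 1‖)) :=
    hρ.mul ((((continuous_conj.tendsto _).comp hF₁).mul hF₁).const_sub 1).norm
  simp only [norm_one, mul_one, map_one, sub_self, norm_zero, mul_zero] at h1 h2
  have h3 := h2.div h1 (sub_pos.2 hρ₀).ne'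
  rw [zero_div] at h3
  have h4 : Tendsto (fun i => F i - F₁ i) l (𝓝 0) := by
    refine squeeze_zero_norm' ?_ h3
    filter_upwards [h, h1.eventually_const_lt (sub_pos.2 hρ₀), hρn] with i hi hpos hn
    simp only [Pi.div_apply]
    rw [le_div_iff₀ hpos]
    have e : 1 - conj (F₁ i) * F i = (1 - conj (F₁ i) * F₁ i) - conj (F₁ i) * (F i - F₁ i) := by
      ring
    have h5 : ‖1 - conj (F₁ i) * F i‖ ≤ ‖1 - conj (F₁ i) * F₁ i‖ + ‖F₁ i‖ * ‖F i - F₁ i‖ := by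
      rw [e]
      refine (norm_sub_le _ _).trans ?_
      rw [norm_mul, RCLike.norm_conj]
    have h6 := hi.trans (mul_le_mul_of_nonneg_left h5 hn)
    linarith
  simpa using h4.add hF₁

namespace IsHyperbolicSelfMap

variable {Φ : ℂ → ℂ} {A : ℝ} {g : ℂ → ℂ}

theorem tendsto_map_mul_I_div (hΦ : IsHyperbolicSelfMap Φ A) {ι : Type*} {l : Filter ι} {t : ι → ℝ}
    (ht : Tendsto t l atTop) : Tendsto (fun i => Φ (t i * I) / t i) l (𝓝 (A * I)) := by
  have h := (hΦ.tendsto_div_self (z := fun i => (t i : ℂ) * I) (l := l) (by simpa using ht)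
    (C := 0) (Eventually.of_forall fun i => by simp)).mul_const I
  refine h.congr' ?_
  filter_upwards [ht.eventually_gt_atTop 0] with i hi
  have : (t i : ℂ) ≠ 0 := ofReal_ne_zero.2 hi.ne'
  have := I_ne_zero
  field_simp

/-- With u = Re g(w) / Im g(w), `hypSq` of A g(w) and g(w) equals (u² + 1)(A - 1)² / A; Schwarz-Pick
bounds it by `hypSq (Φ w) w`. -/
theorem sq_re_div_im_le (hΦ : IsHyperbolicSelfMap Φ A) (hg : IsHoloSelfMap g)
    (hgΦ : ∀ z : ℂ, 0 < z.im → g (Φ z) = A * g z) {w : ℂ} (hw : 0 < w.im) :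
    ((g w).re / (g w).im) ^ 2 ≤ hypSq (Φ w) w * A / (A - 1) ^ 2 - 1 := by
  have hA := hΦ.pos
  have hA1 : 0 < A - 1 := sub_pos.2 hΦ.2.2
  have hgw : 0 < (g w).im := hg.2 hw
  have h := hypSq_map_le hg (hΦ.1.2 hw : 0 < (Φ w).im) hw
  rw [hgΦ w hw] at h
  have e : hypSq (A * g w) (g w) = (((g w).re / (g w).im) ^ 2 + 1) * (A - 1) ^ 2 / A := by
    simp only [hypSq, normSq_apply, sub_re, sub_im, re_ofReal_mul, im_ofReal_mul]
    field_simp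
  rw [e, div_le_iff₀ hA] at h
  rw [le_sub_iff_add_le, le_div_iff₀ (by positivity)]
  exact h

theorem tendsto_re_div_im_mul_I (hΦ : IsHyperbolicSelfMap Φ A) (hg : IsHoloSelfMap g)
    (hgΦ : ∀ z : ℂ, 0 < z.im → g (Φ z) = A * g z) {ι : Type*} {l : Filter ι} {t : ι → ℝ}
    (ht : Tendsto t l atTop) :
    Tendsto (fun i => (g (t i * I)).re / (g (t i * I)).im) l (𝓝 0) := by
  have hA := hΦ.pos
  have hA1 : 0 < A - 1 := sub_pos.2 hΦ.2.2
  have h1 := hΦ.tendsto_map_mul_I_div ht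
  have h2 : Tendsto (fun i => hypSq (Φ (t i * I)) (t i * I)) l (𝓝 ((A - 1) ^ 2 / A)) := by
    have h3 : Tendsto (fun i => normSq (Φ (t i * I) / t i - I) / (Φ (t i * I) / t i).im) l
        (𝓝 (normSq (A * I - I) / (A * I).im)) :=
      ((continuous_normSq.tendsto _).comp (h1.sub_const I)).div
        ((continuous_im.tendsto _).comp h1) (by simpa using hA.ne')
    have e : normSq (A * I - I) / (A * I).im = (A - 1) ^ 2 / A := by
      simp [normSq_apply, sq]
    rw [e] at h3
    refine h3.congr' ?_
    filter_upwards [ht.eventually_gt_atTop 0] with i hi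
    have h4 := (hΦ.1.2 (show 0 < ((t i : ℂ) * I).im by simpa using hi) :
      0 < (Φ (t i * I)).im)
    simp only [hypSq, normSq_apply, sub_re, sub_im, div_ofReal_re, div_ofReal_im, re_ofReal_mul,
      im_ofReal_mul, I_re, I_im]
    field_simp
  have h5 := ((h2.mul_const A).div_const ((A - 1) ^ 2)).sub_const 1
  have e : (A - 1) ^ 2 / A * A / (A - 1) ^ 2 - 1 = 0 := by field_simp; ring
  rw [e] at h5
  have h6 : Tendsto (fun i => ((g (t i * I)).re / (g (t i * I)).im) ^ 2) l (𝓝 0) := by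
    refine squeeze_zero' (Eventually.of_forall fun i => sq_nonneg _) ?_ h5
    filter_upwards [ht.eventually_gt_atTop 0] with i hi
    exact hΦ.sq_re_div_im_le hg hgΦ (by simpa using hi)
  have h7 := h6.sqrt
  simp only [Real.sqrt_sq_eq_abs, Real.sqrt_zero] at h7
  exact (tendsto_zero_iff_abs_tendsto_zero _).2 h7

/-- A solution of the Valiron equation, renormalized at `i t`, tends to the identity as
`t → ∞`. -/
theorem tendsto_renorm (hΦ : IsHyperbolicSelfMap Φ A) (hg : IsHoloSelfMap g)
    (hgΦ : ∀ z : ℂ, 0 < z.im → g (Φ z) = A * g z) {ι : Type*} {l : Filter ι} {t : ι → ℝ}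
    (ht : Tendsto t l atTop) {ζ : ι → ℂ} {ζ₀ : ℂ} (hζ : Tendsto ζ l (𝓝 ζ₀)) (hζ₀ : 0 < ζ₀.im) :
    Tendsto (fun i => g (t i * ζ i) / (g (t i * I)).im) l (𝓝 ζ₀) := by
  have hA := hΦ.pos
  have hI : 0 < I.im := by simp
  have hAI : 0 < ((A : ℂ) * I).im := by simpa using hA
  have hΦt := hΦ.tendsto_map_mul_I_div ht
  have hu := hΦ.tendsto_re_div_im_mul_I hg hgΦ ht
  have hP : Tendsto (fun i => (((g (t i * I)).re / (g (t i * I)).im : ℝ) : ℂ) + I) l (𝓝 I) := by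
    simpa using ((continuous_ofReal.tendsto _).comp hu).add_const I
  set P : ι → ℂ := fun i => (((g (t i * I)).re / (g (t i * I)).im : ℝ) : ℂ) + I with hPdef
  have hpos : ∀ᶠ i in l, 0 < t i := ht.eventually_gt_atTop 0
  have hζpos : ∀ᶠ i in l, 0 < (ζ i).im :=
    ((continuous_im.tendsto _).comp hζ).eventually_const_lt hζ₀
  have hgP : ∀ i, 0 < t i → g (t i * I) = ((g (t i * I)).im : ℝ) * P i := by
    intro i hi
    have : 0 < (g (t i * I)).im := hg.2 (show 0 < ((t i : ℂ) * I).im by simpa using hi)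
    apply Complex.ext
    · simp only [hPdef, re_ofReal_mul, add_re, ofReal_re, I_re]
      field_simp
      ring
    · simp [hPdef]
  have hgim : ∀ i, 0 < t i → 0 < (g (t i * I)).im := fun i hi =>
    hg.2 (show 0 < ((t i : ℂ) * I).im by simpa using hi)
  -- The hyperbolic difference quotient of g at the pair it, Φ(it). It tends to 1 because, after
  -- rescaling, both Cayley values tend to `cayleyAt I (A * I)`.
  set F₁ : ι → ℂ := fun i =>
    cayleyAt (g (t i * I)) (g (Φ (t i * I))) / cayleyAt (t i * I) (Φ (t i * I))
  have hc0 : cayleyAt I (A * I) ≠ 0 := by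
    refine div_ne_zero (fun h => ?_) (sub_conj_ne_zero hAI hI)
    have := congrArg Complex.im h
    simp only [sub_im, im_ofReal_mul, I_im, zero_im] at this
    linarith [hΦ.2.2]
  have hF₁ : Tendsto F₁ l (𝓝 1) := by
    have h1 : Tendsto (fun i => cayleyAt (P i) (A * P i) / cayleyAt I (Φ (t i * I) / t i)) l
        (𝓝 (cayleyAt I (A * I) / cayleyAt I (A * I))) :=
      (tendsto_cayleyAt hP (hP.const_mul _) hI hAI).div
        (tendsto_cayleyAt tendsto_const_nhds hΦt hI hAI) hc0
    rw [div_self hc0] at h1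
    refine h1.congr' ?_
    filter_upwards [hpos] with i hi
    have e1 : cayleyAt (g (t i * I)) (g (Φ (t i * I))) = cayleyAt (P i) (A * P i) := by
      rw [hgΦ _ (by simpa using hi), hgP i hi, mul_left_comm, cayleyAt_real_mul (hgim i hi).ne']
    have e2 : cayleyAt (t i * I) (Φ (t i * I)) = cayleyAt I (Φ (t i * I) / t i) := by
      rw [← cayleyAt_real_mul hi.ne' I, mul_div_cancel₀ _ (ofReal_ne_zero.2 hi.ne')]
    simp only [F₁, e1, e2]
  have hρ : Tendsto (fun i => ‖cayleyAt (Φ (t i * I)) (t i * ζ i)‖) l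
      (𝓝 ‖cayleyAt (A * I) ζ₀‖) := by
    refine (tendsto_cayleyAt hΦt hζ hAI hζ₀).norm.congr' ?_
    filter_upwards [hpos] with i hi
    rw [← cayleyAt_real_mul hi.ne' _ (ζ i), mul_div_cancel₀ _ (ofReal_ne_zero.2 hi.ne')]
  have hex : ∀ i, ∃ F : ℂ, 0 < t i → 0 < (ζ i).im →
      cayleyAt (g (t i * I)) (g (t i * ζ i)) = F * cayleyAt (t i * I) (t i * ζ i) ∧
      ‖F - F₁ i‖ ≤ ‖cayleyAt (Φ (t i * I)) (t i * ζ i)‖ * ‖1 - conj (F₁ i) * F‖ := by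
    intro i
    by_cases h : 0 < t i ∧ 0 < (ζ i).im
    · have hw : 0 < ((t i : ℂ) * I).im := by simpa using h.1
      have hz : 0 < ((t i : ℂ) * ζ i).im := by
        rw [im_ofReal_mul]; exact mul_pos h.1 h.2
      have hne : Φ (t i * I) ≠ t i * I := fun h0 => by
        have h1 := hΦ.mul_im_le hw
        rw [h0] at h1
        nlinarith [hΦ.2.2]
      obtain ⟨F, hF⟩ := exists_cayleyAt_eq_mul hg hw (hΦ.1.2 hw) hz hne
      exact ⟨F, fun _ _ => hF⟩
    -- Dummy value outside the half-plane, which is left only for indices that are eventually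
    -- excluded.
    · exact ⟨0, fun h1 h2 => absurd ⟨h1, h2⟩ h⟩
  choose F hF using hex
  have hFlim : Tendsto F l (𝓝 1) := by
    refine tendsto_one_of_norm_sub_le hF₁ hρ (norm_cayleyAt_lt_one hζ₀ hAI)
      (Eventually.of_forall fun i => norm_nonneg _) ?_
    filter_upwards [hpos, hζpos] with i h1 h2
    exact (hF i h1 h2).2
  have hq : Tendsto (fun i => F i * cayleyAt I (ζ i)) l (𝓝 (cayleyAt I ζ₀)) := by
    simpa using hFlim.mul (tendsto_cayleyAt tendsto_const_nhds hζ hI hζ₀)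
  have h1c : 1 - cayleyAt I ζ₀ ≠ 0 := fun h => by
    have := norm_cayleyAt_lt_one hζ₀ hI
    rw [← sub_eq_zero.1 h, norm_one] at this
    exact lt_irrefl _ this
  -- The inverse Cayley map at `P i`, applied to the Cayley coordinate of the rescaled value of g.
  have hlim : Tendsto (fun i => (P i - conj (P i) * (F i * cayleyAt I (ζ i))) /
      (1 - F i * cayleyAt I (ζ i))) l (𝓝 ζ₀) := by
    have h := (hP.sub (((continuous_conj.tendsto _).comp hP).mul hq)).div (hq.const_sub 1) h1c
    rwa [← eq_div_of_cayleyAt hI hζ₀] at h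
  refine hlim.congr' ?_
  filter_upwards [hpos, hζpos] with i h1 h2
  have h3 : cayleyAt (P i) (g (t i * ζ i) / (g (t i * I)).im) = F i * cayleyAt I (ζ i) := by
    rw [← cayleyAt_real_mul h1.ne' I, ← (hF i h1 h2).1, ← cayleyAt_real_mul (hgim i h1).ne' (P i),
      ← hgP i h1, mul_div_cancel₀ _ (ofReal_ne_zero.2 (hgim i h1).ne')]
  have h4 : 0 < (g (t i * ζ i) / (g (t i * I)).im).im := by
    rw [div_ofReal_im]
    refine div_pos (hg.2 ?_) (hgim i h1)
    change 0 < ((t i : ℂ) * ζ i).im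
    rw [im_ofReal_mul]; exact mul_pos h1 h2
  rw [← h3]
  exact (eq_div_of_cayleyAt (by simp [hPdef]) h4).symm

/-! ### Semi-conformality and the range of the argument -/

theorem tendsto_arg_mul (hΦ : IsHyperbolicSelfMap Φ A) (hg : IsHoloSelfMap g)
    (hgΦ : ∀ z : ℂ, 0 < z.im → g (Φ z) = A * g z) {ζ : ℂ} (hζ : 0 < ζ.im) :
    Tendsto (fun t : ℝ => (g (t * ζ)).arg) atTop (𝓝 ζ.arg) := by
  refine ((continuousAt_arg_of_im_pos hζ).tendsto.comp (hΦ.tendsto_renorm hg hgΦ tendsto_id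
    (tendsto_const_nhds (x := ζ)) hζ)).congr' ?_
  filter_upwards [eventually_gt_atTop 0] with t ht
  have h : 0 < (g (t * I)).im := hg.2 (show 0 < ((t : ℂ) * I).im by simpa using ht)
  simp only [Function.comp_apply, id_eq]
  rw [div_eq_inv_mul, ← ofReal_inv, arg_real_mul _ (inv_pos.2 h)]

theorem map_iterate (hΦ : IsHyperbolicSelfMap Φ A)
    (hgΦ : ∀ z : ℂ, 0 < z.im → g (Φ z) = A * g z) {z : ℂ} (hz : 0 < z.im) (n : ℕ) :
    g (Φ^[n] z) = (A ^ n : ℝ) * g z := by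
  induction n with
  | zero => simp
  | succ n ih =>
    rw [Function.iterate_succ_apply', hgΦ _ (hΦ.iterate_im_pos hz n), ih]
    push_cast
    ring

/-- In a sector, a high point lies at bounded hyperbolic distance from some orbit point Φₙ(i) of
comparable height, and Im g(Φₙ(i)) = Aⁿ Im g(i). -/
theorem tendsto_im_atTop (hΦ : IsHyperbolicSelfMap Φ A) (hg : IsHoloSelfMap g)
    (hgΦ : ∀ z : ℂ, 0 < z.im → g (Φ z) = A * g z) {ι : Type*} {l : Filter ι} {z : ι → ℂ}
    (him : Tendsto (fun i => (z i).im) l atTop) {C : ℝ} (hC0 : 0 < C)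
    (hC : ∀ᶠ i in l, ‖z i‖ ≤ C * (z i).im) :
    Tendsto (fun i => (g (z i)).im) l atTop := by
  have hI : 0 < I.im := by simp
  obtain ⟨C₁, hC₁, hC₁'⟩ := hΦ.exists_abs_iterate_re_le hI
  have hΦI : 0 < (Φ I).im := hΦ.1.2 hI
  set M := hypSq (Φ I) I + 2
  have hM : 0 < M := by linarith [hypSq_nonneg hΦI hI]
  have hstep : ∀ n, (Φ^[n + 1] I).im ≤ M * (Φ^[n] I).im := fun n => hΦ.iterate_im_le_mul hΦI hI n
  have hmono : Monotone fun n => (Φ^[n] I).im := monotone_nat_of_le_succ fun n =>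
    (le_mul_of_one_le_left (hΦ.iterate_im_pos hI n).le hΦ.2.2.le).trans (hΦ.mul_iterate_im_le hI n)
  set S := (C₁ + 1 + C) ^ 2 * M
  have hS : 0 < S + 2 := by positivity
  have hgI : 0 < (g I).im := hg.2 hI
  rw [tendsto_atTop]
  intro B
  obtain ⟨N, hN⟩ := (((tendsto_pow_atTop_atTop_of_one_lt hΦ.2.2).atTop_mul_const
    hgI).eventually_ge_atTop ((S + 2) * B)).exists_forall_of_atTop
  filter_upwards [hC, him.eventually_ge_atTop (Φ^[N] I).im] with i hi1 hi2
  set ζ := z i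
  have hζ : 0 < ζ.im := (hΦ.iterate_im_pos hI N).trans_le hi2
  obtain ⟨n, hnN, hn1, hn2⟩ : ∃ n ≥ N, (Φ^[n] I).im ≤ ζ.im ∧ ζ.im < (Φ^[n + 1] I).im := by
    have hex : ∃ m, ζ.im < (Φ^[m] I).im :=
      ((hΦ.tendsto_iterate_im hI).eventually_gt_atTop ζ.im).exists
    classical
    have hspec := Nat.find_spec hex
    have hlt : N < Nat.find hex := by
      by_contra! h
      exact absurd (hspec.trans_le (hmono h)) (not_lt.2 hi2)
    obtain ⟨m, hm⟩ := Nat.exists_eq_succ_of_ne_zero (Nat.ne_zero_of_lt hlt)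
    refine ⟨m, by omega, not_lt.1 (Nat.find_min hex (by omega)), ?_⟩
    rw [hm] at hspec
    exact hspec
  have hyn := hΦ.iterate_im_pos hI n
  have hb1 : ‖Φ^[n] I‖ ≤ (C₁ + 1) * (Φ^[n] I).im := norm_le_of_abs_re_le (hC₁' n) hyn
  have hb2 : ζ.im ≤ M * (Φ^[n] I).im := hn2.le.trans (hstep n)
  have hhyp : hypSq (Φ^[n] I) ζ ≤ S := by
    rw [hypSq, div_le_iff₀ (mul_pos hyn hζ), normSq_eq_norm_sq]
    have h1 : ‖Φ^[n] I - ζ‖ ≤ (C₁ + 1 + C) * ζ.im := by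
      have h2 := norm_sub_le (Φ^[n] I) ζ
      have h3 := mul_le_mul_of_nonneg_left hn1 (by positivity : 0 ≤ C₁ + 1)
      linarith
    calc ‖Φ^[n] I - ζ‖ ^ 2 ≤ ((C₁ + 1 + C) * ζ.im) ^ 2 := by gcongr
      _ = (C₁ + 1 + C) ^ 2 * (ζ.im * ζ.im) := by ring
      _ ≤ (C₁ + 1 + C) ^ 2 * ((M * (Φ^[n] I).im) * ζ.im) := by gcongr
      _ = S * ((Φ^[n] I).im * ζ.im) := by simp only [S]; ring
  have hle := im_le_of_hypSq_le (hg.2 hyn) (hg.2 hζ) ((hypSq_map_le hg hyn hζ).trans hhyp)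
  rw [hΦ.map_iterate hgΦ hI n, im_ofReal_mul] at hle
  exact le_of_mul_le_mul_left ((hN n hnN).trans hle) hS

theorem exists_norm_le_of_mem_sectorAt {δ : ℝ} (hδ : 0 < δ) :
    ∃ C, 0 < C ∧ ∀ z ∈ sectorAt δ, ‖z‖ ≤ C * z.im := by
  rcases lt_or_ge δ (Real.pi / 2) with hlt | hge
  · have hs : 0 < Real.sin δ := Real.sin_pos_of_pos_of_lt_pi hδ (by linarith [Real.pi_pos])
    refine ⟨(Real.sin δ)⁻¹, inv_pos.2 hs, fun z hz => ?_⟩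
    rw [inv_mul_eq_div, le_div_iff₀ hs]
    have h1 : Real.sin δ ≤ Real.sin z.arg := by
      rw [← Real.cos_pi_div_two_sub, ← Real.cos_sub_pi_div_two, ← Real.cos_abs (z.arg - _)]
      exact Real.cos_le_cos_of_nonneg_of_le_pi (abs_nonneg _) (by linarith [Real.pi_pos]) hz.2.le
    calc ‖z‖ * Real.sin δ ≤ ‖z‖ * Real.sin z.arg := by gcongr
      _ = z.im := norm_mul_sin_arg z
  · exact ⟨1, one_pos, fun z hz => absurd (hz.2.trans_le (by linarith)) (abs_nonneg _).not_gt⟩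

theorem semiConformalAtInfty (hΦ : IsHyperbolicSelfMap Φ A) (hg : IsHoloSelfMap g)
    (hgΦ : ∀ z : ℂ, 0 < z.im → g (Φ z) = A * g z) : SemiConformalAtInfty g := by
  have hsec : ∀ δ : ℝ, 0 < δ → ∃ C, 0 < C ∧
      (∀ᶠ z in Bornology.cobounded ℂ ⊓ 𝓟 (sectorAt δ), ‖z‖ ≤ C * z.im) ∧
      Tendsto (fun z : ℂ => ‖z‖) (Bornology.cobounded ℂ ⊓ 𝓟 (sectorAt δ)) atTop ∧
      Tendsto im (Bornology.cobounded ℂ ⊓ 𝓟 (sectorAt δ)) atTop := by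
    intro δ hδ
    obtain ⟨C, hC, h⟩ := exists_norm_le_of_mem_sectorAt hδ
    have h1 : ∀ᶠ z in Bornology.cobounded ℂ ⊓ 𝓟 (sectorAt δ), ‖z‖ ≤ C * z.im :=
      mem_of_superset (mem_inf_of_right (mem_principal_self _)) h
    have h2 : Tendsto (fun z : ℂ => ‖z‖) (Bornology.cobounded ℂ ⊓ 𝓟 (sectorAt δ)) atTop :=
      tendsto_norm_cobounded_atTop.mono_left inf_le_left
    refine ⟨C, hC, h1, h2, ?_⟩
    refine tendsto_atTop_mono' _ ?_ (h2.const_mul_atTop (inv_pos.2 hC))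
    filter_upwards [h1] with z hz
    rwa [inv_mul_le_iff₀ hC]
  refine ⟨fun δ hδ => ?_, fun δ hδ => ?_⟩
  · obtain ⟨C, hC, h1, -, h3⟩ := hsec δ hδ
    rw [← tendsto_norm_atTop_iff_cobounded]
    exact tendsto_atTop_mono (fun z => (le_abs_self _).trans (abs_im_le_norm _))
      (hΦ.tendsto_im_atTop hg hgΦ h3 hC h1)
  · obtain ⟨C, hC, h1, h2, -⟩ := hsec δ hδ
    -- Along an ultrafilter the directions z / ‖z‖ converge in the compact arc `K`, so
    -- `tendsto_renorm` applies with t = ‖z‖ and a moving ζ; this gives uniformity over the sector.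
    rw [tendsto_iff_ultrafilter]
    intro f hf
    have h1' : ∀ᶠ z in (f : Filter ℂ), ‖z‖ ≤ C * z.im := hf h1
    have h2' : Tendsto (fun z : ℂ => ‖z‖) f atTop := h2.mono_left hf
    have hpos := h2'.eventually_gt_atTop 0
    let K : Set ℂ := Metric.sphere 0 1 ∩ {ζ | C⁻¹ ≤ ζ.im}
    have hK : IsCompact K :=
      (isCompact_sphere 0 1).inter_right (isClosed_le continuous_const continuous_im)
    have hmem : ∀ᶠ z in (f : Filter ℂ), z / (‖z‖ : ℂ) ∈ K := by
      filter_upwards [h1', hpos] with z hz hz0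
      refine ⟨?_, ?_⟩
      · rw [mem_sphere_zero_iff_norm, norm_div, norm_real, norm_norm, div_self hz0.ne']
      · change C⁻¹ ≤ (z / (‖z‖ : ℂ)).im
        rw [div_ofReal_im, le_div_iff₀ hz0, inv_mul_le_iff₀ hC]
        exact hz
    obtain ⟨ζ₀, hζ₀, hlim⟩ := hK.ultrafilter_le_nhds (f.map fun z => z / (‖z‖ : ℂ))
      (le_principal_iff.2 hmem)
    have hlim : Tendsto (fun z : ℂ => z / (‖z‖ : ℂ)) f (𝓝 ζ₀) := hlim
    have him : 0 < ζ₀.im := (inv_pos.2 hC).trans_le hζ₀.2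
    have hne : ζ₀ ≠ 0 := fun h => by simp [h] at him
    have hG := hΦ.tendsto_renorm hg hgΦ h2' hlim him
    have hq := hG.div hlim hne
    rw [div_self hne] at hq
    have harg := (continuousAt_arg one_mem_slitPlane).tendsto.comp hq
    rw [arg_one] at harg
    refine harg.congr' ?_
    filter_upwards [hpos] with z hz
    have hz' : (‖z‖ : ℂ) ≠ 0 := ofReal_ne_zero.2 hz.ne'
    have hgz : 0 < (g (‖z‖ * I)).im := hg.2 (show 0 < ((‖z‖ : ℂ) * I).im by simpa using hz)
    have e : g (‖z‖ * (z / ‖z‖)) / (g (‖z‖ * I)).im / (z / ‖z‖) =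
        ((‖z‖ / (g (‖z‖ * I)).im : ℝ) : ℂ) * (g z / z) := by
      rw [mul_div_cancel₀ _ hz']
      have hz0 : z ≠ 0 := norm_pos_iff.1 hz
      have := ofReal_ne_zero.2 hgz.ne'
      push_cast
      field_simp
    simp only [Function.comp_apply, Pi.div_apply]
    rw [e, arg_real_mul _ (div_pos hz hgz)]

theorem exists_arg_eq (hΦ : IsHyperbolicSelfMap Φ A) (hg : IsHoloSelfMap g)
    (hgΦ : ∀ z : ℂ, 0 < z.im → g (Φ z) = A * g z) {α : ℝ} (hα : α ∈ Ioo 0 Real.pi) :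
    ∃ z : ℂ, 0 < z.im ∧ (g z).arg = α := by
  have him : ∀ s ∈ Ioo 0 Real.pi, 0 < (exp (s * I)).im := fun s hs => by
    rw [exp_ofReal_mul_I_im]; exact Real.sin_pos_of_mem_Ioo hs
  have harg : ∀ s ∈ Ioo 0 Real.pi, (exp (s * I)).arg = s := fun s hs => by
    rw [exp_mul_I, arg_cos_add_sin_mul_I ⟨by linarith [hs.1, Real.pi_pos], hs.2.le⟩]
  obtain ⟨a, ha0, haα⟩ := exists_between hα.1
  obtain ⟨b, hbα, hbπ⟩ := exists_between hα.2
  have ha : a ∈ Ioo 0 Real.pi := ⟨ha0, haα.trans hα.2⟩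
  have hb : b ∈ Ioo 0 Real.pi := ⟨hα.1.trans hbα, hbπ⟩
  have h1 := hΦ.tendsto_arg_mul hg hgΦ (him a ha)
  have h2 := hΦ.tendsto_arg_mul hg hgΦ (him b hb)
  rw [harg a ha] at h1
  rw [harg b hb] at h2
  -- One radius t serves both rays; on the arc of radius t between them arg g passes from below α to
  -- above α.
  obtain ⟨t, ⟨ht1, ht2⟩, ht⟩ := (((h1.eventually_lt_const haα).and
    (h2.eventually_const_lt hbα)).and (eventually_gt_atTop 0)).exists
  have hpos : ∀ s ∈ Icc a b, 0 < ((t : ℂ) * exp (s * I)).im := fun s hs => by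
    rw [im_ofReal_mul]
    exact mul_pos ht (him s ⟨ha0.trans_le hs.1, hs.2.trans_lt hbπ⟩)
  have hcont : ContinuousOn (fun s : ℝ => (g (t * exp (s * I))).arg) (Icc a b) := by
    intro s hs
    have h3 : ContinuousAt (fun s : ℝ => (t : ℂ) * exp (s * I)) s := by fun_prop
    have h4 : ContinuousAt g (t * exp (s * I)) := (hg.1.differentiableAt
      (UpperHalfPlane.isOpen_upperHalfPlaneSet.mem_nhds (hpos s hs))).continuousAt
    have h5 : ContinuousAt arg (g (t * exp (s * I))) :=
      continuousAt_arg_of_im_pos (hg.2 (hpos s hs))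
    exact (ContinuousAt.comp (f := fun s : ℝ => g (t * exp (s * I))) h5
      (ContinuousAt.comp (f := fun s : ℝ => (t : ℂ) * exp (s * I)) h4 h3)).continuousWithinAt
  obtain ⟨s, hs, hsα⟩ := intermediate_value_Icc (haα.trans hbα).le hcont ⟨ht1.le, ht2.le⟩
  exact ⟨_, hpos s hs, hsα⟩

end IsHyperbolicSelfMap

/-! ### Assembly -/

theorem mainTheorem5 (Φ : ℂ → ℂ) (A : ℝ) (hΦ : IsHyperbolicSelfMap Φ A) :
    ∃ θ b : ℂ → ℝ,
      (∀ z₀ ∈ UpperHalfPlane.upperHalfPlaneSet,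
        θ z₀ ∈ Set.Ioo 0 Real.pi ∧
        Filter.Tendsto (fun n : ℕ => (Φ^[n] z₀).arg) Filter.atTop (nhds (θ z₀)) ∧
        Filter.Tendsto
          (fun n : ℕ => ((Φ^[n + 1] z₀).re - (Φ^[n] z₀).re) / (Φ^[n] z₀).im)
          Filter.atTop (nhds (b z₀)) ∧
        b z₀ = (A - 1) * Real.cot (θ z₀)) ∧
      ContinuousOn b UpperHalfPlane.upperHalfPlaneSet ∧
      (∀ z₀ ∈ UpperHalfPlane.upperHalfPlaneSet,
        ∃ σ σhat : ℂ → ℂ,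
          IsHoloSelfMap σ ∧
          TendstoLocallyUniformlyOn (renormIter Φ z₀) σ Filter.atTop
            UpperHalfPlane.upperHalfPlaneSet ∧
          (∀ z ∈ UpperHalfPlane.upperHalfPlaneSet,
            σ (Φ z) = (A : ℂ) * σ z + (b z₀ : ℂ)) ∧
          (∀ z, σhat z = σ z + (b z₀ : ℂ) / ((A : ℂ) - 1)) ∧
          IsHoloSelfMap σhat ∧
          SemiConformalAtInfty σhat ∧
          (∀ z ∈ UpperHalfPlane.upperHalfPlaneSet, σhat (Φ z) = (A : ℂ) * σhat z) ∧
          (∀ z ∈ UpperHalfPlane.upperHalfPlaneSet, θ z = (σhat z).arg)) ∧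
      (∀ α ∈ Set.Ioo 0 Real.pi,
        ∃ z₀ ∈ UpperHalfPlane.upperHalfPlaneSet, θ z₀ = α) := by
  refine ⟨fun z => arg (orbitSlope Φ z + I), fun z => (A - 1) * orbitSlope Φ z,
    fun z hz => ⟨arg_mem_Ioo_of_im_pos (by simp), hΦ.tendsto_arg_iterate hz, hΦ.tendsto_step hz,
      by simp [cot_arg]⟩,
    hΦ.continuousOn_orbitSlope.const_mul _ , fun w hw => ?_, fun α hα => ?_⟩
  · have hA : (A : ℂ) - 1 ≠ 0 := by
      rw [← ofReal_one, ← ofReal_sub]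
      exact ofReal_ne_zero.2 (sub_pos.2 hΦ.2.2).ne'
    have hV := hΦ.isHoloSelfMap_valironMap hw
    have hVΦ : ∀ z : ℂ, 0 < z.im → valironMap Φ w (Φ z) = A * valironMap Φ w z :=
      fun z hz => hΦ.valironMap_map hz hw
    -- Since b(w) / (A - 1) is the slope subtracted in σ, the shifted map σ̂ is the Valiron map
    -- itself.
    refine ⟨_, _, hΦ.isHoloSelfMap_valironMap_sub hw, hΦ.tendstoLocallyUniformlyOn_renormIter hw,
      fun z hz => ?_, fun z => ?_, hV, hΦ.semiConformalAtInfty hV hVΦ, hVΦ,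
      fun z hz => (hΦ.arg_valironMap hz hw).symm⟩
    · rw [hVΦ z hz]
      push_cast
      ring
    · push_cast
      field_simp
      ring
  -- Any base point would do: the argument of the Valiron map does not depend on it.
  · have hI : 0 < I.im := by simp
    obtain ⟨z, hz, h⟩ := hΦ.exists_arg_eq (hΦ.isHoloSelfMap_valironMap hI)
      (fun z hz => hΦ.valironMap_map hz hI) hα
    exact ⟨z, hz, (hΦ.arg_valironMap hz hI).symm.trans h⟩
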